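/- Let $n,k\in\mathbb N$, let $\Omega_0,\dots,\Omega_k\subset\mathbb R^n$ be bounded open sets, let $t_0,\dots,t_k\in(0,1]$ with $\sum_{i=0}^k t_i=1$, and put $\Omega_t=\{\sum_i t_iy_i : y_i\in\Omega_i\}$. Let $v_i:\Omega_i\to\mathbb R$ be continuous and bounded from below, extended by $+\infty$ outside $\Omega_i$, and let $$w(x)=\inf\Big\{\sum_{i=0}^k t_iv_i(y_i) : y_0,\dots,y_k\in\mathbb R^n,\ x=\sum_{i=0}^k t_iy_i\Big\}$$ be their weighted infimal convolution, which is finite on $\Omega_t$. Let $S^n$ be the set of real symmetric $n\times n$ matrices, with $X\le Y$ meaning that $Y-X$ is positive semidefinite. For an open set $\Omega$, a function $u:\Omega\to\mathbb R$ and $x\in\Omega$, the second-order subjet $J^{2-}u(x)$ is the set of $(\xi,A)\in\mathbb R^n\times S^n$ with $u(y)\ge u(x)+\langle\xi,y-x\rangle+\frac12\langle A(y-x),y-x\rangle+o(|y-x|^2)$ as $y\to x$, $y\in\Omega$. The closed subjet $\overline J^{2-}u(x)$ is the set of limits of sequences $(\xi_m,A_m)\in J^{2-}u(z_m)$ with $z_m\in\Omega$,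 $z_m\to x$ and $u(z_m)\to u(x)$. Suppose that the infimum defining $w$ is attained at $x\in\Omega_t$: $x=\sum_i t_ix_i$ and $w(x)=\sum_i t_iv_i(x_i)$ with $x_i\in\Omega_i$. Let $(\xi,A)\in J^{2-}w(x)$. Then for every $\varepsilon>0$ there exist $A_0,\dots,A_k\in S^n$ such that $(\xi,A_i)\in\overline J^{2-}v_i(x_i)$ for $i=0,\dots,k$ and $$A-\varepsilon A^2\le\sum_{i=0}^k t_iA_i .$$ If, in addition, $A\ge0$ and $\varepsilon$ is so small that $I-\varepsilon A$ is positive definite, then these matrices also satisfy $A_i\ge0$ for every $i$ and $$A-\varepsilon A^2\le\Big(\sum_{i=0}^k t_iA_i^{-1}\Big)^{-1},$$ where, if some $A_i$ is singular, the right-hand side means $\lim_{\delta\to0^+}\big(\sum_i t_i(A_i+\delta I)^{-1}\big)^{-1}$ (the existence of this limit is part of the claim). -/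

import Mathlib

open Filter Topology

noncomputable section

/-- The weighted Minkowski combination `t₀ Ω₀ + ⋯ + t_k Ω_k`. -/
def minkowskiComb {n k : ℕ} (t : Fin (k + 1) → ℝ)
    (Ω : Fin (k + 1) → Set (EuclideanSpace ℝ (Fin n))) : Set (EuclideanSpace ℝ (Fin n)) :=
  {x | ∃ y : Fin (k + 1) → EuclideanSpace ℝ (Fin n), (∀ i, y i ∈ Ω i) ∧ x = ∑ i, t i • y i}

open Classical in
/-- The extension by `+∞` to the whole space of (the restriction to `Ω` of) a real function. -/
def extendTop {n : ℕ} (Ω : Set (EuclideanSpace ℝ (Fin n))) (v : EuclideanSpace ℝ (Fin n) → ℝ)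
    (x : EuclideanSpace ℝ (Fin n)) : EReal :=
  if x ∈ Ω then (v x : EReal) else ⊤

/-- The weighted infimal convolution of the functions `v i : Ω i → ℝ`, extended by `+∞`:
the infimum of `∑ i, t i * v i (y i)` over all `y` with `x = ∑ i, t i • y i`. -/
def infConv {n k : ℕ} (t : Fin (k + 1) → ℝ) (Ω : Fin (k + 1) → Set (EuclideanSpace ℝ (Fin n)))
    (v : Fin (k + 1) → EuclideanSpace ℝ (Fin n) → ℝ) (x : EuclideanSpace ℝ (Fin n)) : EReal :=
  ⨅ y : {y : Fin (k + 1) → EuclideanSpace ℝ (Fin n) // x = ∑ i, t i • y i},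
    ∑ i, (t i : EReal) * extendTop (Ω i) (v i) (y.1 i)

/-- On the Minkowski combination of the domains, the infimal convolution of functions bounded
from below is finite; so passing to `EReal.toReal` there loses nothing. -/
theorem infConv_finite {n k : ℕ} (t : Fin (k + 1) → ℝ) (ht : ∀ i, 0 < t i)
    (Ω : Fin (k + 1) → Set (EuclideanSpace ℝ (Fin n)))
    (v : Fin (k + 1) → EuclideanSpace ℝ (Fin n) → ℝ) (hv : ∀ i, BddBelow (v i '' Ω i))
    (x : EuclideanSpace ℝ (Fin n)) (hx : x ∈ minkowskiComb t Ω) :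
    ((infConv t Ω v x).toReal : EReal) = infConv t Ω v x := by
  have hsum : ∀ f : Fin (k + 1) → ℝ,
      ((∑ i, t i * f i : ℝ) : EReal) = ∑ i, (t i : EReal) * (f i : EReal) := by
    intro f
    refine Finset.induction_on (motive := fun s =>
      ((∑ i ∈ s, t i * f i : ℝ) : EReal) = ∑ i ∈ s, (t i : EReal) * (f i : EReal))
      Finset.univ (by simp) fun i s hi ih => ?_
    rw [Finset.sum_insert hi, Finset.sum_insert hi, EReal.coe_add, EReal.coe_mul, ih]
  choose c hc using hv
  apply EReal.coe_toReal
  · obtain ⟨y, hy, hxy⟩ := hx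
    refine ne_top_of_le_ne_top ?_ (iInf_le _ ⟨y, hxy⟩)
    have : ∑ i, (t i : EReal) * extendTop (Ω i) (v i) (y i)
        = ((∑ i, t i * v i (y i) : ℝ) : EReal) := by
      rw [hsum]
      exact Finset.sum_congr rfl fun i _ => by simp [extendTop, hy i]
    rw [this]
    exact EReal.coe_ne_top _
  · refine ne_bot_of_le_ne_bot (EReal.coe_ne_bot (∑ i, t i * c i)) (le_iInf fun y => ?_)
    rw [hsum]
    refine Finset.sum_le_sum fun i _ => ?_
    refine mul_le_mul_of_nonneg_left ?_ (by exact_mod_cast (ht i).le)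
    unfold extendTop
    split_ifs with h
    · exact_mod_cast hc i ⟨_, h, rfl⟩
    · exact le_top

/-- The second order subjet at `x` of a function `u : Ω → ℝ`: the pairs `(ξ, A)`, with `A` a
symmetric matrix, such that, as `y → x` in `Ω`,
`u y ≥ u x + ⟨ξ, y - x⟩ + (1 / 2) * ⟨A (y - x), y - x⟩ + o(‖y - x‖ ^ 2)`. -/
def subjet {n : ℕ} (Ω : Set (EuclideanSpace ℝ (Fin n))) (u : EuclideanSpace ℝ (Fin n) → ℝ)
    (x : EuclideanSpace ℝ (Fin n)) :
    Set (EuclideanSpace ℝ (Fin n) × Matrix (Fin n) (Fin n) ℝ) :=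
  {p | p.2.IsSymm ∧ ∀ η : ℝ, 0 < η → ∀ᶠ y in 𝓝[Ω] x,
    u x + inner ℝ p.1 (y - x) + (1 / 2) * inner ℝ (Matrix.toEuclideanLin p.2 (y - x)) (y - x)
      - η * ‖y - x‖ ^ 2 ≤ u y}

/-- The closed second order subjet at `x` of `u : Ω → ℝ`: the limits `(ξ, A)` of pairs
`(ξₘ, Aₘ)` in the subjets of `u` at points `zₘ ∈ Ω` with `zₘ → x` and `u zₘ → u x`. -/
def closedSubjet {n : ℕ} (Ω : Set (EuclideanSpace ℝ (Fin n)))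
    (u : EuclideanSpace ℝ (Fin n) → ℝ) (x : EuclideanSpace ℝ (Fin n)) :
    Set (EuclideanSpace ℝ (Fin n) × Matrix (Fin n) (Fin n) ℝ) :=
  {p | ∃ (z : ℕ → EuclideanSpace ℝ (Fin n))
      (q : ℕ → EuclideanSpace ℝ (Fin n) × Matrix (Fin n) (Fin n) ℝ),
    (∀ m, z m ∈ Ω) ∧ (∀ m, q m ∈ subjet Ω u (z m)) ∧
    Tendsto z atTop (𝓝 x) ∧ Tendsto (fun m => u (z m)) atTop (𝓝 (u x)) ∧
    Tendsto q atTop (𝓝 p)}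

/-- `H` is the weighted harmonic mean `(∑ i, t i (A i)⁻¹)⁻¹` of the nonnegative symmetric
matrices `A i`, which may be singular: the limit as `δ → 0⁺` of the same expression in the
positive definite matrices `A i + δ I`. -/
def IsHarmonicMean {n k : ℕ} (t : Fin (k + 1) → ℝ)
    (A : Fin (k + 1) → Matrix (Fin n) (Fin n) ℝ) (H : Matrix (Fin n) (Fin n) ℝ) : Prop :=
  Tendsto (fun δ : ℝ => (∑ i, t i • (A i + δ • (1 : Matrix (Fin n) (Fin n) ℝ))⁻¹)⁻¹)
    (𝓝[>] 0) (𝓝 H)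

end

/-! Since $w$ lies below every competitor and the infimum is attained at $(x_i)$, the functions
$g_i(y)=v_i(x_i+y)-v_i(x_i)-\langle\xi,y\rangle$ satisfy, for all $\eta>0$ and small $y$, $\sum
t_ig_i(y_i)\ge\frac12\langle A\,Ty,Ty\rangle-\eta|Ty|^2$, where $Ty=\sum t_iy_i$. This is a contact
problem in the product space, treated as in the theorem on sums for viscosity solutions.

Replacing $A$ by $A-\varepsilon A^2$ (less a small multiple of $I$) pays for a penalty
$l|y_i-u_i|^2/2$ (`coupling_le_of_le`), so the inf-convolutions `lo` of the $g_i$ still dominate the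
form. A sup-convolution of twice the parameter turns `lo` into a $C^{1,1}$ function `hi`, with `lo ≤
hi`. Jensen's lemma (`exists_hessian_ge`) gives points near the origin where every `hi` has a second
order expansion and the Hessians $X_i$ satisfy, up to a small error, $\sum t_i\langle
X_ih_i,h_i\rangle\ge\langle C\,Th,Th\rangle$. At such a point $u$, the lower bound on $X_i$ makes
$u$ the midpoint of `z u` and `a (z u)` (`eq_midpoint`), so the jet moves unchanged to $g_i$ at `a
(z u)` (`hi_sub_le`). As $\|X_i\|\le2l$ with $l$ fixed, compactness yields limits.

The limiting block inequality, with $C=A-\varepsilon A^2$, contains every claim: equal $h_i$ give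
the arithmetic bound, a single nonzero $h_i$ gives $A_i\ge0$, and $h_i=A_i^{-1}k$ gives the harmonic
bound. -/

open Metric

noncomputable section

/-! ### Inf-convolution followed by sup-convolution (Lasry–Lions regularization) -/

variable {E : Type*} [NormedAddCommGroup E] [InnerProductSpace ℝ E]

/-- Data for the regularization of `g` on a closed ball by an infimal convolution of parameter `l`
(`lo`, attained at `a`) followed by a supremal convolution of parameter `2 * l` (`hi`, attained
at `z`). -/
structure DoubleConv {E : Type*} [NormedAddCommGroup E] (g : E → ℝ) (r l : ℝ)
    (lo hi : E → ℝ) (a z : E → E) : Prop where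
  lo_le : ∀ y ∈ closedBall (0 : E) r, ∀ x, lo x ≤ g y + l / 2 * ‖y - x‖ ^ 2
  a_mem : ∀ x, a x ∈ closedBall (0 : E) r
  lo_eq : ∀ x, lo x = g (a x) + l / 2 * ‖a x - x‖ ^ 2
  le_hi : ∀ u x, lo x - l * ‖u - x‖ ^ 2 ≤ hi u
  hi_eq : ∀ u, hi u = lo (z u) - l * ‖u - z u‖ ^ 2


theorem eq_two_smul_sub_of_eq_midpoint {u x y : E} (h : u = (1 / 2 : ℝ) • (x + y)) :
    y = (2 : ℝ) • u - x := by
  rw [h]; module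

/-- The infimum is over a compact ball. The supremum is attained because `lo` is continuous and
grows at most like $\frac l2|x|^2$, which the penalty $l|u-x|^2$ beats: hence the doubled parameter.
-/
theorem exists_doubleConv [FiniteDimensional ℝ E] {g : E → ℝ} {r l : ℝ} (hr : 0 ≤ r) (hl : 0 < l)
    (hg : ContinuousOn g (closedBall 0 r)) :
    ∃ (lo hi : E → ℝ) (a z : E → E), DoubleConv g r l lo hi a z := by
  have h1 : ∀ x : E, ∃ a ∈ closedBall (0 : E) r, ∀ y ∈ closedBall (0 : E) r,
      g a + l / 2 * ‖a - x‖ ^ 2 ≤ g y + l / 2 * ‖y - x‖ ^ 2 := by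
    intro x
    have hc : ContinuousOn (fun y => g y + l / 2 * ‖y - x‖ ^ 2) (closedBall 0 r) :=
      hg.add (by fun_prop)
    obtain ⟨a, ha, hmin⟩ := (isCompact_closedBall (0 : E) r).exists_isMinOn
      ⟨0, mem_closedBall_self hr⟩ hc
    exact ⟨a, ha, fun y hy => hmin hy⟩
  choose a ha hmin using h1
  set lo : E → ℝ := fun x => g (a x) + l / 2 * ‖a x - x‖ ^ 2 with hlo
  have hstep : ∀ x x', lo x' - lo x ≤ l / 2 * ((2 * r + ‖x‖ + ‖x'‖) * ‖x' - x‖) := by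
    intro x x'
    have h2 : lo x' ≤ g (a x) + l / 2 * ‖a x - x'‖ ^ 2 := hmin x' _ (ha x)
    have h3 : ‖a x - x'‖ ^ 2 - ‖a x - x‖ ^ 2 ≤ (2 * r + ‖x‖ + ‖x'‖) * ‖x' - x‖ := by
      have har : ‖a x‖ ≤ r := by simpa using ha x
      have e1 := norm_sub_le (a x) x
      have e2 := norm_sub_le (a x) x'
      have e3 : ‖a x - x'‖ - ‖a x - x‖ ≤ ‖x' - x‖ := by
        have := norm_sub_norm_le (a x - x') (a x - x)
        rwa [show a x - x' - (a x - x) = -(x' - x) by abel, norm_neg] at this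
      nlinarith [norm_nonneg (a x - x'), norm_nonneg (a x - x), norm_nonneg (x' - x)]
    have h4 := mul_le_mul_of_nonneg_left h3 (half_pos hl).le
    simp only [hlo] at h2 ⊢
    linarith
  have hcont : Continuous lo := by
    rw [continuous_iff_continuousAt]
    intro x
    have hlim : Tendsto (fun x' => l / 2 * ((2 * r + ‖x‖ + ‖x'‖) * ‖x' - x‖)) (𝓝 x) (𝓝 0) := by
      have : Continuous (fun x' : E => l / 2 * ((2 * r + ‖x‖ + ‖x'‖) * ‖x' - x‖)) := by fun_prop
      simpa using this.tendsto x
    rw [ContinuousAt, tendsto_iff_dist_tendsto_zero]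
    refine squeeze_zero (fun _ => dist_nonneg) (fun x' => ?_) hlim
    rw [Real.dist_eq, abs_le]
    have e1 := hstep x x'
    have e2 := hstep x' x
    rw [norm_sub_rev x x'] at e2
    constructor <;> linarith
  have h2 : ∀ u : E, ∃ z, ∀ x, lo x - l * ‖u - x‖ ^ 2 ≤ lo z - l * ‖u - z‖ ^ 2 := by
    intro u
    have hc : Continuous (fun x => lo x - l * ‖u - x‖ ^ 2) := by fun_prop
    refine hc.exists_forall_ge' 0 ?_
    have hbd : ∀ x, lo x ≤ g 0 + l / 2 * ‖x‖ ^ 2 := fun x => by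
      simpa using hmin x 0 (mem_closedBall_self hr)
    -- Beyond this radius the functional is at most its value at $0$.
    set R : ℝ := 4 * ‖u‖ + 2 * |g 0 - lo 0| / l + 1 with hR
    have hev : ∀ᶠ x in cocompact E, R ≤ ‖x‖ :=
      (tendsto_norm_cocompact_atTop (E := E)).eventually_ge_atTop R
    filter_upwards [hev] with x hx
    have h5 : ‖x‖ - ‖u‖ ≤ ‖u - x‖ := by rw [norm_sub_rev]; exact norm_sub_norm_le x u
    have hu := norm_nonneg u
    have hq : 0 ≤ 2 * |g 0 - lo 0| / l := by positivity
    have h6 : (‖x‖ - ‖u‖) ^ 2 ≤ ‖u - x‖ ^ 2 := by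
      apply pow_le_pow_left₀ <;> linarith
    have h7 : |g 0 - lo 0| = l / 2 * (2 * |g 0 - lo 0| / l) := by field_simp
    have h8 := le_abs_self (g 0 - lo 0)
    set Q := 2 * |g 0 - lo 0| / l
    have h9 : Q ≤ (1 / 2) * ‖x‖ ^ 2 - 2 * ‖x‖ * ‖u‖ + ‖u‖ ^ 2 - ‖u‖ ^ 2 + Q / 2 := by
      have : Q + 1 ≤ ‖x‖ - 4 * ‖u‖ := by linarith
      nlinarith
    have h10 := mul_le_mul_of_nonneg_left h9 hl.le
    have h11 := mul_le_mul_of_nonneg_left h6 hl.le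
    have h12 := hbd x
    simp only [sub_zero]
    nlinarith
  choose z hz using h2
  exact ⟨lo, fun u => lo (z u) - l * ‖u - z u‖ ^ 2, a, z, fun y hy x => hmin x y hy, ha,
    fun _ => rfl, fun u x => hz u x, fun _ => rfl⟩

namespace DoubleConv

variable {g : E → ℝ} {r l : ℝ} {lo hi : E → ℝ} {a z : E → E}

theorem lo_le_hi {E : Type*} [NormedAddCommGroup E] {g : E → ℝ} {r l : ℝ} {lo hi : E → ℝ}
    {a z : E → E} (h : DoubleConv g r l lo hi a z) (u : E) : lo u ≤ hi u := by
  simpa using h.le_hi u u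

/-- The parallelogram bound $|y-z|^2\le2|u-z|^2+2|u-y|^2$ makes the penalty of `lo` at `z u` absorb
exactly the one subtracted in `hi`. -/
theorem hi_le (h : DoubleConv g r l lo hi a z) (hl : 0 < l) (u : E) {y : E}
    (hy : y ∈ closedBall (0 : E) r) : hi u ≤ g y + l * ‖u - y‖ ^ 2 := by
  have h1 := h.lo_le y hy (z u)
  have h2 : ‖y - z u‖ ^ 2 ≤ 2 * ‖u - z u‖ ^ 2 + 2 * ‖u - y‖ ^ 2 := by
    have := parallelogram_law_with_norm ℝ (u - z u) (u - y)
    rw [show u - z u - (u - y) = y - z u by abel] at this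
    nlinarith [norm_nonneg (u - z u + (u - y))]
  rw [h.hi_eq]
  nlinarith

/-- Test both suprema with the midpoint `m` of `z u` and `z u'`. Semiconcavity of `lo`, seen by
using `a m` at both ends, costs $l|d|^2$, while the penalties gain $2l|d|^2+2l\langle
d,u-u'\rangle$. -/
theorem lipschitz (h : DoubleConv g r l lo hi a z) (hl : 0 < l) (u u' : E) :
    ‖z u - z u'‖ ≤ 4 * ‖u - u'‖ := by
  obtain ⟨d, hd⟩ : ∃ d : E, d = (1 / 2 : ℝ) • (z u' - z u) := ⟨_, rfl⟩
  obtain ⟨m, hm⟩ : ∃ m : E, m = z u + d := ⟨_, rfl⟩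
  have hz' : z u' = z u + (2 : ℝ) • d := by rw [hd, smul_smul]; simp
  have e1 := h.lo_eq m
  have e2 := h.lo_le _ (h.a_mem m) (z u)
  have e3 := h.lo_le _ (h.a_mem m) (z u')
  have e4 := h.le_hi u m
  have e5 := h.le_hi u' m
  rw [h.hi_eq] at e4 e5
  have p1 : ‖a m - z u‖ ^ 2 + ‖a m - z u'‖ ^ 2 = 2 * ‖a m - m‖ ^ 2 + 2 * ‖d‖ ^ 2 := by
    have := parallelogram_law_with_norm ℝ (a m - m) d
    rw [show a m - m + d = a m - z u by rw [hm]; abel,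
      show a m - m - d = a m - z u' by rw [hm, hz', two_smul]; abel] at this
    nlinarith
  have p2 : ‖u - z u‖ ^ 2 - ‖u - m‖ ^ 2 + ‖u' - z u'‖ ^ 2 - ‖u' - m‖ ^ 2
      = 2 * ‖d‖ ^ 2 + 2 * inner ℝ d (u - u') := by
    have q1 : u - z u = (u - m) + d := by rw [hm]; abel
    have q2 : u' - z u' = (u' - m) - d := by rw [hm, hz', two_smul]; abel
    have q3 : u - u' = (u - m) - (u' - m) := by abel
    rw [q1, q2, q3, norm_add_sq_real, norm_sub_sq_real (u' - m), inner_sub_right d,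
      real_inner_comm d, real_inner_comm d]
    ring
  have p3 : ‖d‖ ^ 2 ≤ -2 * inner ℝ d (u - u') := by
    have : l * ‖d‖ ^ 2 ≤ l * (-2 * inner ℝ d (u - u')) := by nlinarith
    exact le_of_mul_le_mul_left this hl
  have p4 : -inner ℝ d (u - u') ≤ ‖d‖ * ‖u - u'‖ := by
    have := abs_real_inner_le_norm d (u - u')
    linarith [neg_abs_le (inner ℝ d (u - u'))]
  have p5 : ‖d‖ ≤ 2 * ‖u - u'‖ := by
    by_contra! hlt
    nlinarith [norm_nonneg d, norm_nonneg (u - u')]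
  rw [norm_sub_rev, hz', add_sub_cancel_left, norm_smul]
  norm_num
  linarith

/-- Keep the maximizer `z u` as a competitor at `u'`. -/
theorem le_hi_add (h : DoubleConv g r l lo hi a z) (u u' : E) :
    hi u + inner ℝ ((2 * l) • (z u - u)) (u' - u) - l * ‖u' - u‖ ^ 2 ≤ hi u' := by
  have h1 := h.le_hi u' (z u)
  have h2 := h.hi_eq u
  have h3 : ‖u' - z u‖ ^ 2 = ‖u' - u‖ ^ 2 - 2 * inner ℝ (z u - u) (u' - u) + ‖u - z u‖ ^ 2 := by
    rw [show u' - z u = (u' - u) - (z u - u) by abel, norm_sub_sq_real, real_inner_comm,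
      norm_sub_rev u]
  rw [real_inner_smul_left]
  rw [h3] at h1
  linarith

/-- Exchange the two points in `le_hi_add` and compare gradients by `lipschitz`; the constant is
$7=8-2+1$. -/
theorem hi_le_add (h : DoubleConv g r l lo hi a z) (hl : 0 < l) (u u' : E) :
    hi u' ≤ hi u + inner ℝ ((2 * l) • (z u - u)) (u' - u) + 7 * l * ‖u' - u‖ ^ 2 := by
  have h1 := h.le_hi_add u' u
  have h2 : inner ℝ (z u' - z u) (u' - u) ≤ 4 * ‖u' - u‖ ^ 2 := by
    have := real_inner_le_norm (z u' - z u) (u' - u)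
    have := h.lipschitz hl u' u
    nlinarith [norm_nonneg (u' - u)]
  have h3 : inner ℝ (z u' - u') (u - u') =
      -inner ℝ (z u' - z u) (u' - u) - inner ℝ (z u - u) (u' - u) + ‖u' - u‖ ^ 2 := by
    rw [show z u' - u' = (z u' - z u) + (z u - u) - (u' - u) by abel,
      show u - u' = -(u' - u) by abel, inner_neg_right, inner_sub_left, inner_add_left,
      real_inner_self_eq_norm_sq]
    ring
  rw [real_inner_smul_left] at h1 ⊢
  rw [h3, norm_sub_rev u u'] at h1
  nlinarith

theorem hasFDerivAt (h : DoubleConv g r l lo hi a z) (hl : 0 < l) (u : E) :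
    HasFDerivAt hi (innerSL ℝ ((2 * l) • (z u - u))) u := by
  rw [hasFDerivAt_iff_isLittleO_nhds_zero]
  have hO : (fun k => hi (u + k) - hi u - innerSL ℝ ((2 * l) • (z u - u)) k) =O[𝓝 0]
      fun k : E => ‖k‖ ^ 2 := by
    refine Asymptotics.IsBigO.of_bound (7 * l) (Eventually.of_forall fun k => ?_)
    have h1 := h.le_hi_add u (u + k)
    have h2 := h.hi_le_add hl u (u + k)
    simp only [add_sub_cancel_left] at h1 h2
    simp only [innerSL_apply_apply]
    rw [Real.norm_eq_abs, Real.norm_eq_abs, abs_le, abs_of_nonneg (by positivity)]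
    have : 0 ≤ l * ‖k‖ ^ 2 := by positivity
    constructor <;> linarith
  refine hO.trans_isLittleO ?_
  have : (fun k : E => ‖k‖ ^ 2) =o[𝓝 0] fun k => ‖k‖ ^ 1 :=
    Asymptotics.isLittleO_norm_pow_norm_pow (by norm_num)
  simp only [pow_one] at this
  exact this.of_norm_right

theorem lo_zero {E : Type*} [NormedAddCommGroup E] {g : E → ℝ} {r l : ℝ} {lo hi : E → ℝ}
    {a z : E → E} (h : DoubleConv g r l lo hi a z) (hr : 0 ≤ r) (h0 : g 0 = 0) (h1 : 0 ≤ lo 0) :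
    lo 0 = 0 := by
  have := h.lo_le 0 (mem_closedBall_self hr) 0
  simp [h0] at this
  linarith

theorem z_zero {E : Type*} [NormedAddCommGroup E] {g : E → ℝ} {r l : ℝ} {lo hi : E → ℝ}
    {a z : E → E} (h : DoubleConv g r l lo hi a z) (hr : 0 ≤ r) (hl : 0 < l)
    (h0 : g 0 = 0) (h1 : 0 ≤ lo 0) : z 0 = 0 := by
  have e1 := h.lo_le_hi 0
  have e2 := h.lo_le 0 (mem_closedBall_self hr) (z 0)
  rw [h.hi_eq] at e1
  simp only [h0, zero_sub, norm_neg, zero_add] at e1 e2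
  have : ‖z 0‖ ^ 2 ≤ 0 := by nlinarith
  simpa using this

theorem hi_zero {E : Type*} [NormedAddCommGroup E] {g : E → ℝ} {r l : ℝ} {lo hi : E → ℝ}
    {a z : E → E} (h : DoubleConv g r l lo hi a z) (hr : 0 ≤ r) (hl : 0 < l)
    (h0 : g 0 = 0) (h1 : 0 ≤ lo 0) : hi 0 = 0 := by
  rw [h.hi_eq, h.z_zero hr hl h0 h1, h.lo_zero hr h0 h1]; simp

theorem norm_z_le (h : DoubleConv g r l lo hi a z) (hr : 0 ≤ r) (hl : 0 < l) (h0 : g 0 = 0)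
    (h1 : 0 ≤ lo 0) (u : E) : ‖z u‖ ≤ 4 * ‖u‖ := by
  have := h.lipschitz hl u 0
  rwa [h.z_zero hr hl h0 h1, sub_zero, sub_zero] at this

/-- On the segment from `u` to the midpoint of `z u` and `a (z u)`, the regularization is
bounded above by a quadratic function of opening `2 * l`. -/
theorem hi_segment_le (h : DoubleConv g r l lo hi a z) (hl : 0 < l) (u : E) {s : ℝ}
    (hs0 : 0 ≤ s) (hs1 : s ≤ 1) :
    hi (u + s • ((1 / 2 : ℝ) • (z u + a (z u)) - u)) ≤
      lo (z u) - l * ‖u + s • ((1 / 2 : ℝ) • (z u + a (z u)) - u) - z u‖ ^ 2 := by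
  obtain ⟨w, hw⟩ : ∃ w : E, w = u + s • ((1 / 2 : ℝ) • (z u + a (z u)) - u) := ⟨_, rfl⟩
  rw [← hw]
  obtain ⟨k, hk⟩ : ∃ k : E, k = z w - z u := ⟨_, rfl⟩
  obtain ⟨b, hb⟩ : ∃ b : E, b = a (z u) - z u := ⟨_, rfl⟩
  obtain ⟨c, hc⟩ : ∃ c : E, c = u - z u := ⟨_, rfl⟩
  have e1 := h.le_hi u (z w)
  have e2 := h.lo_le _ (h.a_mem (z u)) (z w)
  have e3 := h.lo_eq (z u)
  rw [h.hi_eq] at e1 ⊢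
  have q1 : u - z w = c - k := by rw [hc, hk]; abel
  have q2 : a (z u) - z w = b - k := by rw [hb, hk]; abel
  have q4 : w - z u = (1 - s) • c + (s / 2) • b := by
    rw [hw, hb, hc]; module
  have q3 : w - z w = (1 - s) • c + (s / 2) • b - k := by rw [← q4, hk]; abel
  rw [q1, ← hc] at e1
  rw [q2] at e2
  rw [← hb] at e3
  rw [q3, q4]
  rw [norm_sub_sq_real] at e1 e2
  rw [norm_sub_sq_real ((1 - s) • c + (s / 2) • b), inner_add_left, real_inner_smul_left,
    real_inner_smul_left]
  have f1 : lo (z w) - lo (z u) ≤ l * (‖k‖ ^ 2 - 2 * inner ℝ c k) := by nlinarith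
  have f2 : lo (z w) - lo (z u) ≤ l * (‖k‖ ^ 2 / 2 - inner ℝ b k) := by nlinarith
  have f3 : 0 ≤ s * (l * ‖k‖ ^ 2) := by positivity
  -- The weights $1-s$ and $s$ combine $c$ and $b/2$ into `w - z u`, so the inner products with $k$
  -- match exactly.
  have f4 := mul_le_mul_of_nonneg_left f1 (sub_nonneg.2 hs1)
  have f5 := mul_le_mul_of_nonneg_left f2 hs0
  nlinarith

/-- If the regularization satisfies at `u` a second order lower bound with opening less than
`2 * l`, then `u` is the midpoint of `z u` and `a (z u)`. -/
theorem eq_midpoint (h : DoubleConv g r l lo hi a z) (hl : 0 < l) (u : E) {M : ℝ} (hM : M < 2 * l)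
    (hu : ∀ᶠ y in 𝓝 u, hi u + inner ℝ ((2 * l) • (z u - u)) (y - u) - M / 2 * ‖y - u‖ ^ 2 ≤ hi y) :
    u = (1 / 2 : ℝ) • (z u + a (z u)) := by
  obtain ⟨k, hk⟩ : ∃ k : E, k = (1 / 2 : ℝ) • (z u + a (z u)) - u := ⟨_, rfl⟩
  suffices k = 0 by rw [hk, sub_eq_zero] at this; exact this.symm
  have hc : Tendsto (fun s : ℝ => u + s • k) (𝓝[>] 0) (𝓝 u) := by
    have : Continuous (fun s : ℝ => u + s • k) := by fun_prop
    simpa using (this.tendsto 0).mono_left nhdsWithin_le_nhds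
  obtain ⟨s, hs, hs0, hs1⟩ := ((hc.eventually hu).and (Ioc_mem_nhdsGT one_pos)).exists
  have e1 := h.hi_segment_le hl u hs0.le hs1
  rw [← hk] at e1
  have e2 := h.hi_eq u
  have e3 : ‖u + s • k - z u‖ ^ 2 =
      ‖u - z u‖ ^ 2 - 2 * s * inner ℝ (z u - u) k + s ^ 2 * ‖k‖ ^ 2 := by
    rw [show u + s • k - z u = (u - z u) + s • k by abel, norm_add_sq_real, real_inner_smul_right,
      norm_smul, mul_pow, Real.norm_eq_abs, sq_abs, show u - z u = -(z u - u) by abel,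
      inner_neg_left]
    ring
  rw [add_sub_cancel_left, real_inner_smul_left, real_inner_smul_right, norm_smul, mul_pow,
    Real.norm_eq_abs, sq_abs] at hs
  -- Along the segment, the upper bound has second order term $-l s^2|k|^2$ and the lower one
  -- $-\frac M2s^2|k|^2$, with the same linear term; $M<2l$ then forces $k=0$.
  have e4 : (l - M / 2) * (s ^ 2 * ‖k‖ ^ 2) ≤ 0 := by rw [e3] at e1; nlinarith
  have e5 : s ^ 2 * ‖k‖ ^ 2 ≤ 0 := by
    by_contra! hlt
    nlinarith
  have e6 : 0 < s ^ 2 := by positivity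
  have e7 : ‖k‖ ^ 2 ≤ 0 := by
    by_contra! hlt
    nlinarith
  simpa using e7

/-- At a midpoint `hi_le` is an equality for $y=$ `a (z u)`. Moving both points by $k$ leaves the
penalty unchanged, so a subjet of `hi` at `u` is one of `g` at `a (z u)`. -/
theorem hi_sub_le (h : DoubleConv g r l lo hi a z) (hl : 0 < l) {u : E}
    (hu : u = (1 / 2 : ℝ) • (z u + a (z u))) {k : E}
    (hk : a (z u) + k ∈ closedBall (0 : E) r) :
    hi (u + k) - hi u ≤ g (a (z u) + k) - g (a (z u)) := by
  have h1 := h.hi_le hl (u + k) hk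
  have h2 := h.hi_eq u
  have h3 := h.lo_eq (z u)
  have q1 : a (z u) - z u = (2 : ℝ) • (u - z u) := by
    rw [eq_two_smul_sub_of_eq_midpoint hu]; module
  have q2 : u + k - (a (z u) + k) = -(u - z u) := by
    rw [eq_two_smul_sub_of_eq_midpoint hu]; module
  rw [q2, norm_neg] at h1
  rw [q1, norm_smul, mul_pow] at h3
  norm_num at h3
  linarith

/-- The same equality case of `hi_le`, now with only `u` moved; it bounds the Hessian above by $2l$.
-/
theorem hi_le_hi_add_of_eq_midpoint (h : DoubleConv g r l lo hi a z) (hl : 0 < l) {u : E}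
    (hu : u = (1 / 2 : ℝ) • (z u + a (z u))) (k : E) :
    hi (u + k) ≤ hi u + inner ℝ ((2 * l) • (z u - u)) k + l * ‖k‖ ^ 2 := by
  have h1 := h.hi_le hl (u + k) (h.a_mem (z u))
  have h2 := h.hi_eq u
  have h3 := h.lo_eq (z u)
  have q1 : a (z u) - z u = (2 : ℝ) • (u - z u) := by
    rw [eq_two_smul_sub_of_eq_midpoint hu]; module
  have q2 : u + k - a (z u) = (z u - u) + k := by
    rw [eq_two_smul_sub_of_eq_midpoint hu]; module
  rw [q2, norm_add_sq_real, norm_sub_rev] at h1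
  rw [q1, norm_smul, mul_pow] at h3
  norm_num at h3
  rw [real_inner_smul_left]
  linarith

end DoubleConv

/-! ### Second order expansions and points of differentiability -/

theorem inner_symm_of_hasFDerivAt {f : E → ℝ} {b : E → E} {u : E} {X : E →L[ℝ] E}
    (hf : ∀ y, HasFDerivAt f (innerSL ℝ (b y)) y) (hb : HasFDerivAt b X u) (v w : E) :
    inner ℝ (X v) w = inner ℝ (X w) v := by
  have h1 : HasFDerivAt (fun y => (innerSL ℝ (b y) : E →L[ℝ] ℝ))
      ((innerSL ℝ : E →L[ℝ] E →L[ℝ] ℝ).comp X) u :=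
    (innerSL ℝ : E →L[ℝ] E →L[ℝ] ℝ).hasFDerivAt.comp u hb
  simpa using second_derivative_symmetric hf h1 v w

/-- The second order Taylor expansion at a point where the gradient is differentiable. -/
theorem taylor_two_of_hasFDerivAt_gradient {f : E → ℝ} {b : E → E} {u : E} {X : E →L[ℝ] E}
    (hf : ∀ y, HasFDerivAt f (innerSL ℝ (b y)) y) (hb : HasFDerivAt b X u) {η : ℝ} (hη : 0 < η) :
    ∀ᶠ y in 𝓝 u,
      |f y - f u - inner ℝ (b u) (y - u) - (1 / 2) * inner ℝ (X (y - u)) (y - u)| ≤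
        η * ‖y - u‖ ^ 2 := by
  have hX := inner_symm_of_hasFDerivAt hf hb
  obtain ⟨ρ, hρ, hball⟩ := Metric.eventually_nhds_iff_ball.1 (hb.isLittleO.bound hη)
  refine Metric.eventually_nhds_iff_ball.2 ⟨ρ, hρ, fun y hy => ?_⟩
  set R : E → ℝ := fun y => f y - inner ℝ (b u) (y - u) - (1 / 2) * inner ℝ (X (y - u)) (y - u)
    with hR
  have hd : ∀ y, HasFDerivAt R (innerSL ℝ (b y - b u - X (y - u))) y := by
    intro y
    have e0 : HasFDerivAt (fun y => y - u) (ContinuousLinearMap.id ℝ E) y :=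
      (hasFDerivAt_id y).sub_const u
    have e1 : HasFDerivAt (fun y => X (y - u)) X y :=
      (X.hasFDerivAt.comp y e0).congr_fderiv (by ext; simp)
    have e2 := ((hf y).sub ((hasFDerivAt_const (b u) y).inner ℝ e0)).sub
      ((e1.inner ℝ e0).const_mul (1 / 2))
    refine e2.congr_fderiv ?_
    ext w
    have h3 := hX w (y - u)
    have h4 := real_inner_comm w (X (y - u))
    simp only [sub_apply, smul_apply, innerSL_apply_apply,
      ContinuousLinearMap.comp_apply, ContinuousLinearMap.prod_apply, fderivInnerCLM_apply,
      ContinuousLinearMap.id_apply, zero_apply, inner_zero_left, smul_eq_mul,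
      inner_sub_left _ _ w]
    linarith
  -- The gradient of the remainder at $w$ is $b(w)-b(u)-X(w-u)$, by symmetry of $X$; it is at most
  -- $\eta|w-u|$ in norm on the ball.
  have hmv := (convex_closedBall u ‖y - u‖).norm_image_sub_le_of_norm_hasFDerivWithin_le
    (f := R) (C := η * ‖y - u‖) (x := u) (y := y)
    (fun w _ => (hd w).hasFDerivWithinAt) (fun w hw => ?_)
    (mem_closedBall_self (norm_nonneg _)) (by simp [dist_eq_norm])
  · have e : R y - R u =
        f y - f u - inner ℝ (b u) (y - u) - (1 / 2) * inner ℝ (X (y - u)) (y - u) := by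
      simp [hR]; ring
    rw [e, Real.norm_eq_abs] at hmv
    calc _ ≤ _ := hmv
      _ = _ := by ring
  · rw [innerSL_apply_norm]
    have hw' : ‖w - u‖ ≤ ‖y - u‖ := by simpa [dist_eq_norm] using hw
    have hwb : w ∈ ball u ρ := by
      rw [mem_ball, dist_eq_norm] at hy ⊢
      exact hw'.trans_lt hy
    exact (hball w hwb).trans (mul_le_mul_of_nonneg_left hw' hη.le)

/-- Otherwise $S$ is null by Rademacher's theorem, and so is its Lipschitz image, which contains a
ball. Hausdorff measure of full dimension serves both facts. -/
theorem exists_mem_differentiableAt_of_ball_subset_image {V W : Type*} [NormedAddCommGroup V]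
    [NormedSpace ℝ V] [FiniteDimensional ℝ V] [NormedAddCommGroup W] [NormedSpace ℝ W]
    [FiniteDimensional ℝ W] {P : V → V} {Z : V → W} {K K' : NNReal} (hP : LipschitzWith K P)
    (hZ : LipschitzWith K' Z) {S : Set V} {c : V} {ρ : ℝ} (hρ : 0 < ρ) (hS : ball c ρ ⊆ P '' S) :
    ∃ x ∈ S, DifferentiableAt ℝ Z x := by
  let _ : MeasurableSpace V := borel V
  have _ : BorelSpace V := ⟨rfl⟩
  by_contra! hcon
  let μ : MeasureTheory.Measure V := MeasureTheory.Measure.hausdorffMeasure (Module.finrank ℝ V)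
  have hnull : μ S = 0 :=
    MeasureTheory.measure_mono_null (fun x hx => hcon x hx) (hZ.ae_differentiableAt (μ := μ))
  have himg : μ (P '' S) = 0 := by
    have := hP.hausdorffMeasure_image_le (d := (Module.finrank ℝ V : ℝ)) (Nat.cast_nonneg _) S
    refine le_antisymm (this.trans ?_) zero_le
    change _ * μ S ≤ 0
    rw [hnull, mul_zero]
  exact (measure_ball_pos μ c hρ).ne' (MeasureTheory.measure_mono_null hS himg)

theorem nonpos_of_forall_mul_le_sq_mul {α K : ℝ} (h : ∀ s : ℝ, 0 < s → s * α ≤ s ^ 2 * K) :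
    α ≤ 0 := by
  by_contra! hα
  have hK : 0 < |K| + 1 := by positivity
  have h1 := h (α / (2 * (|K| + 1))) (by positivity)
  have h2 : α ≤ α / (2 * (|K| + 1)) * K := by
    have hs : 0 < α / (2 * (|K| + 1)) := by positivity
    refine le_of_mul_le_mul_left ?_ hs
    linarith [h1]
  have h3 : α / (2 * (|K| + 1)) * K ≤ α / (2 * (|K| + 1)) * (|K| + 1) :=
    mul_le_mul_of_nonneg_left (by linarith [le_abs_self K]) (by positivity)
  have h4 : α / (2 * (|K| + 1)) * (|K| + 1) = α / 2 := by field_simp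
  linarith

theorem le_of_forall_pos_le_add_mul {x y c : ℝ} (h : ∀ η : ℝ, 0 < η → x ≤ y + η * c) : x ≤ y := by
  have hlim : Tendsto (fun η : ℝ => y + η * c) (𝓝[>] 0) (𝓝 y) := by
    have : Continuous (fun η : ℝ => y + η * c) := by fun_prop
    simpa using (this.tendsto 0).mono_left nhdsWithin_le_nhds
  exact ge_of_tendsto hlim (eventually_mem_nhdsWithin.mono fun η hη => h η hη)

/-! ### The coupled quadratic form and the perturbed functional -/

section Contact

variable {ι : Type*} [Fintype ι]

/-- The quadratic form `⟨C T u, T u⟩`, with `T u = ∑ i, t i • u i`. -/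
def coupling (C : E →L[ℝ] E) (t : ι → ℝ) (u : ι → E) : ℝ :=
  inner ℝ (C (∑ i, t i • u i)) (∑ i, t i • u i)

theorem coupling_add_smul {C : E →L[ℝ] E} (hC : ∀ v w, inner ℝ (C v) w = inner ℝ (C w) v)
    (t : ι → ℝ) (u h : ι → E) (s : ℝ) :
    coupling C t (fun i => u i + s • h i) = coupling C t u
      + 2 * s * ∑ i, t i * inner ℝ (C (∑ j, t j • u j)) (h i) + s ^ 2 * coupling C t h := by
  have e1 : ∑ i, t i • (u i + s • h i) = ∑ i, t i • u i + s • ∑ i, t i • h i := by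
    simp only [smul_add, Finset.sum_add_distrib, Finset.smul_sum, smul_comm s]
  have e2 : ∑ i, t i * inner ℝ (C (∑ j, t j • u j)) (h i)
      = inner ℝ (C (∑ j, t j • u j)) (∑ i, t i • h i) := by
    simp only [inner_sum, real_inner_smul_right]
  rw [e2]
  unfold coupling
  rw [e1, map_add, map_smul, inner_add_left, inner_add_right, inner_add_right,
    real_inner_smul_left, real_inner_smul_left, real_inner_smul_right, real_inner_smul_right,
    hC (∑ i, t i • h i) (∑ i, t i • u i)]
  ring

theorem sq_norm_le_sum {E : Type*} [NormedAddCommGroup E] (u : ι → E) :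
    ‖u‖ ^ 2 ≤ ∑ i, ‖u i‖ ^ 2 := by
  have h0 : 0 ≤ ∑ i, ‖u i‖ ^ 2 := Finset.sum_nonneg fun i _ => by positivity
  rw [← Real.le_sqrt (norm_nonneg _) h0]
  refine (pi_norm_le_iff_of_nonneg (Real.sqrt_nonneg _)).2 fun i => ?_
  rw [Real.le_sqrt (norm_nonneg _) h0]
  exact Finset.single_le_sum (f := fun i => ‖u i‖ ^ 2) (fun i _ => by positivity)
    (Finset.mem_univ i)

/-- The perturbed functional minimized in the proof of Jensen's lemma. -/
def perturbed (hi : ι → E → ℝ) (C : E →L[ℝ] E) (t : ι → ℝ) (δ : ℝ) (p u : ι → E) : ℝ :=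
  ∑ i, t i * hi i (u i) - (1 / 2) * coupling C t u + δ / 2 * ∑ i, ‖u i‖ ^ 2
    - ∑ i, inner ℝ (p i) (u i)

/-- The gradient of the unperturbed functional `perturbed hi C t δ 0`. -/
def perturbedGrad (z : ι → E → E) (C : E →L[ℝ] E) (t : ι → ℝ) (l δ : ℝ) (u : ι → E) (i : ι) : E :=
  t i • (2 * l) • (z i (u i) - u i) - t i • C (∑ j, t j • u j) + δ • u i

/-- Serves twice at a minimizer: with $c_i=7l|h_i|^2$ it yields the first order condition, with the
Taylor expansion the second order one. -/
theorem perturbed_add_le {hi : ι → E → ℝ} {z : ι → E → E} {C : E →L[ℝ] E}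
    (hC : ∀ v w, inner ℝ (C v) w = inner ℝ (C w) v) {t : ι → ℝ} (ht : ∀ i, 0 ≤ t i) {l δ : ℝ}
    {p u h : ι → E} {s : ℝ} {c : ι → ℝ}
    (hc : ∀ i, hi i (u i + s • h i) ≤
      hi i (u i) + s * inner ℝ ((2 * l) • (z i (u i) - u i)) (h i) + s ^ 2 * c i) :
    perturbed hi C t δ p (fun i => u i + s • h i) ≤ perturbed hi C t δ p u
      + s * ∑ i, inner ℝ (perturbedGrad z C t l δ u i - p i) (h i)
      + s ^ 2 * (∑ i, t i * c i - (1 / 2) * coupling C t h + δ / 2 * ∑ i, ‖h i‖ ^ 2) := by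
  have e2 : ∀ i, ‖u i + s • h i‖ ^ 2
      = ‖u i‖ ^ 2 + 2 * s * inner ℝ (u i) (h i) + s ^ 2 * ‖h i‖ ^ 2 := fun i => by
    rw [norm_add_sq_real, real_inner_smul_right, norm_smul, mul_pow, Real.norm_eq_abs, sq_abs]
    ring
  have e3 := Finset.sum_le_sum fun i (_ : i ∈ Finset.univ) =>
    add_le_add_left (mul_le_mul_of_nonneg_left (hc i) (ht i))
      (-s * (t i * inner ℝ (C (∑ j, t j • u j)) (h i)) + δ / 2 * ‖u i + s • h i‖ ^ 2
        - inner ℝ (p i) (u i + s • h i))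
  have e4 : ∀ i, t i * (hi i (u i) + s * inner ℝ ((2 * l) • (z i (u i) - u i)) (h i) + s ^ 2 * c i)
      + (-s * (t i * inner ℝ (C (∑ j, t j • u j)) (h i)) + δ / 2 * ‖u i + s • h i‖ ^ 2
        - inner ℝ (p i) (u i + s • h i))
      = t i * hi i (u i) + δ / 2 * ‖u i‖ ^ 2 - inner ℝ (p i) (u i)
        + s * inner ℝ (perturbedGrad z C t l δ u i - p i) (h i)
        + (s ^ 2 * (t i * c i) + s ^ 2 * (δ / 2 * ‖h i‖ ^ 2)) := fun i => by
    simp only [e2, perturbedGrad, inner_add_right, inner_sub_left, inner_add_left,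
      real_inner_smul_right, real_inner_smul_left]
    ring
  simp only [e4] at e3
  unfold perturbed
  rw [coupling_add_smul hC]
  simp only [Finset.sum_add_distrib, Finset.sum_sub_distrib, ← Finset.mul_sum] at e3
  linarith

end Contact

/-! ### Jensen's lemma for the regularized functions -/

section Jensen

variable {ι : Type*} [Fintype ι] {g : ι → E → ℝ} {r l : ℝ} {lo hi : ι → E → ℝ} {a z : ι → E → E}
  {t : ι → ℝ} {C : E →L[ℝ] E} {δ : ℝ}

theorem perturbedGrad_lipschitz (hD : ∀ i, DoubleConv (g i) r l (lo i) (hi i) (a i) (z i))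
    (hl : 0 < l) (ht : ∀ i, 0 ≤ t i) (ht_sum : ∑ i, t i = 1) (hδ : 0 < δ) :
    ∃ K, LipschitzWith K (perturbedGrad z C t l δ) := by
  refine ⟨Real.toNNReal (10 * l + ‖C‖ + δ), LipschitzWith.of_dist_le' fun u w => ?_⟩
  have ht1 : ∀ i, t i ≤ 1 := fun i =>
    ht_sum ▸ Finset.single_le_sum (f := t) (fun i _ => ht i) (Finset.mem_univ i)
  rw [dist_eq_norm, dist_eq_norm]
  refine (pi_norm_le_iff_of_nonneg (by positivity)).2 fun i => ?_
  have hi' : ‖u i - w i‖ ≤ ‖u - w‖ := norm_le_pi_norm (u - w) i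
  have hT : ‖∑ j, t j • u j - ∑ j, t j • w j‖ ≤ ‖u - w‖ := by
    rw [← Finset.sum_sub_distrib]
    calc _ ≤ ∑ j, ‖t j • u j - t j • w j‖ := norm_sum_le _ _
      _ ≤ ∑ j, t j * ‖u - w‖ := Finset.sum_le_sum fun j _ => by
          rw [← smul_sub, norm_smul, Real.norm_of_nonneg (ht j)]
          exact mul_le_mul_of_nonneg_left (norm_le_pi_norm (u - w) j) (ht j)
      _ = ‖u - w‖ := by rw [← Finset.sum_mul, ht_sum, one_mul]
  have hzl : ‖z i (u i) - z i (w i)‖ ≤ 4 * ‖u i - w i‖ := (hD i).lipschitz hl _ _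
  have e : (perturbedGrad z C t l δ u - perturbedGrad z C t l δ w) i =
      t i • ((2 * l) • ((z i (u i) - z i (w i)) - (u i - w i))
        - C (∑ j, t j • u j - ∑ j, t j • w j)) + δ • (u i - w i) := by
    simp only [Pi.sub_apply, perturbedGrad, map_sub]; module
  have n1 : ‖(2 * l) • ((z i (u i) - z i (w i)) - (u i - w i))‖ ≤ 10 * l * ‖u - w‖ := by
    rw [norm_smul, Real.norm_of_nonneg (by positivity)]
    have := norm_sub_le (z i (u i) - z i (w i)) (u i - w i)
    nlinarith
  have n2 : ‖C (∑ j, t j • u j - ∑ j, t j • w j)‖ ≤ ‖C‖ * ‖u - w‖ :=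
    (C.le_opNorm _).trans (mul_le_mul_of_nonneg_left hT (norm_nonneg _))
  have n3 : ‖δ • (u i - w i)‖ ≤ δ * ‖u - w‖ := by
    rw [norm_smul, Real.norm_of_nonneg hδ.le]; gcongr
  rw [e]
  refine (norm_add_le _ _).trans ?_
  rw [norm_smul (t i), Real.norm_of_nonneg (ht i)]
  have n4 := norm_sub_le ((2 * l) • ((z i (u i) - z i (w i)) - (u i - w i)))
    (C (∑ j, t j • u j - ∑ j, t j • w j))
  have n5 := mul_le_of_le_one_left (norm_nonneg ((2 * l) • ((z i (u i) - z i (w i)) - (u i - w i))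
    - C (∑ j, t j • u j - ∑ j, t j • w j))) (ht1 i)
  linarith

/-- Young's inequality absorbs the linear term in half of the $\delta$ term. This gives coercivity,
and minimizers close to $0$ when $p$ is small. -/
theorem perturbed_ge (hcoup : ∀ u, (1 / 2) * coupling C t u ≤ ∑ i, t i * hi i (u i)) (hδ : 0 < δ)
    (p u : ι → E) :
    δ / 4 * ‖u‖ ^ 2 - Fintype.card ι * ‖p‖ ^ 2 / δ ≤ perturbed hi C t δ p u := by
  have h1 : ∀ i, δ / 4 * ‖u i‖ ^ 2 - ‖p‖ ^ 2 / δ ≤ δ / 2 * ‖u i‖ ^ 2 - inner ℝ (p i) (u i) := by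
    intro i
    have e1 := real_inner_le_norm (p i) (u i)
    have e2 : ‖p i‖ * ‖u i‖ ≤ ‖p‖ * ‖u i‖ :=
      mul_le_mul_of_nonneg_right (norm_le_pi_norm p i) (norm_nonneg _)
    have e3 : ‖p‖ * ‖u i‖ ≤ δ / 4 * ‖u i‖ ^ 2 + ‖p‖ ^ 2 / δ := by
      have : 0 ≤ (δ / 2 * ‖u i‖ - ‖p‖) ^ 2 / δ := by positivity
      have e4 : (δ / 2 * ‖u i‖ - ‖p‖) ^ 2 / δ
          = δ / 4 * ‖u i‖ ^ 2 - ‖p‖ * ‖u i‖ + ‖p‖ ^ 2 / δ := by field_simp; ring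
      linarith
    linarith
  have h2 := Finset.sum_le_sum fun i (_ : i ∈ Finset.univ) => h1 i
  simp only [Finset.sum_sub_distrib, ← Finset.mul_sum, Finset.sum_const, Finset.card_univ,
    nsmul_eq_mul] at h2
  have h3 := hcoup u
  have h4 := mul_le_mul_of_nonneg_left (sq_norm_le_sum u) (by positivity : 0 ≤ δ / 4)
  unfold perturbed
  rw [mul_div_assoc]
  linarith

/-- A form of Jensen's lemma: if a weighted sum of regularizations dominates a quadratic form and
both vanish at the origin, then arbitrarily close to the origin there is a point where all the
gradients are differentiable and the Hessian of the difference is almost nonnegative. -/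
theorem exists_hessian_ge [FiniteDimensional ℝ E]
    (hD : ∀ i, DoubleConv (g i) r l (lo i) (hi i) (a i) (z i))
    (hl : 0 < l) (ht : ∀ i, 0 ≤ t i) (ht_sum : ∑ i, t i = 1)
    (hC : ∀ v w, inner ℝ (C v) w = inner ℝ (C w) v)
    (hcoup : ∀ u, (1 / 2) * coupling C t u ≤ ∑ i, t i * hi i (u i)) (h0 : ∀ i, hi i 0 = 0)
    (hδ : 0 < δ) :
    ∃ (u : ι → E) (X : ι → E →L[ℝ] E), ‖u‖ < δ ∧
      (∀ i, HasFDerivAt (fun y => (2 * l) • (z i y - y)) (X i) (u i)) ∧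
      ∀ h : ι → E, coupling C t h - δ * ∑ i, ‖h i‖ ^ 2 ≤ ∑ i, t i * inner ℝ (X i (h i)) (h i) := by
  classical
  obtain ⟨K, hK⟩ := perturbedGrad_lipschitz (C := C) hD hl ht ht_sum hδ
  have hZ : LipschitzWith 4 (fun (u : ι → E) i => z i (u i)) := by
    refine LipschitzWith.of_dist_le_mul fun u w => ?_
    rw [dist_eq_norm, dist_eq_norm]
    refine (pi_norm_le_iff_of_nonneg (by positivity)).2 fun i => ?_
    refine ((hD i).lipschitz hl _ _).trans ?_
    exact mul_le_mul_of_nonneg_left (norm_le_pi_norm (u - w) i) (by norm_num)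
  have hhi : ∀ i, Continuous (hi i) := fun i =>
    continuous_iff_continuousAt.2 fun u => ((hD i).hasFDerivAt hl u).continuousAt
  have hFc : ∀ p, Continuous (perturbed hi C t δ p) := fun p => by
    unfold perturbed coupling; fun_prop
  have hF0 : ∀ p, perturbed hi C t δ p 0 = 0 := fun p => by
    simp [perturbed, coupling, h0]
  set S : Set (ι → E) := {u | ‖u‖ < δ ∧ ∃ p, perturbedGrad z C t l δ u = p ∧
    ∀ w, perturbed hi C t δ p u ≤ perturbed hi C t δ p w} with hS
  set N : ℝ := (Fintype.card ι : ℝ) with hN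
  have hN0 : 0 ≤ N := Nat.cast_nonneg _
  -- Each small $p$ is the unperturbed gradient at a minimizer of the functional tilted by $p$. The
  -- radius makes $N|p|^2/\delta<\delta^3/4$, hence $|u|<\delta$.
  have hsub : ball (0 : ι → E) (δ ^ 2 / (2 * (N + 1))) ⊆ perturbedGrad z C t l δ '' S := by
    intro p hp
    have hp' : ‖p‖ < δ ^ 2 / (2 * (N + 1)) := by simpa using hp
    obtain ⟨u, hu⟩ := (hFc p).exists_forall_le' 0 (by
      have hev : ∀ᶠ x : ι → E in cocompact (ι → E), N * ‖p‖ ^ 2 / δ / (δ / 4) + 1 ≤ ‖x‖ :=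
        tendsto_norm_cocompact_atTop.eventually_ge_atTop _
      filter_upwards [hev] with x hx
      rw [hF0]
      refine le_trans ?_ (perturbed_ge hcoup hδ p x)
      have h1 : 0 ≤ N * ‖p‖ ^ 2 / δ / (δ / 4) := by positivity
      have h2 : N * ‖p‖ ^ 2 / δ / (δ / 4) ≤ ‖x‖ ^ 2 := by nlinarith
      rw [div_le_iff₀ (by positivity)] at h2
      linarith)
    have hgrad : perturbedGrad z C t l δ u = p := by
      set h : ι → E := fun i => p i - perturbedGrad z C t l δ u i with hh
      have key : ∑ i, ‖h i‖ ^ 2 ≤ 0 := by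
        refine nonpos_of_forall_mul_le_sq_mul (K := ∑ i, t i * (7 * l * ‖h i‖ ^ 2)
          - (1 / 2) * coupling C t h + δ / 2 * ∑ i, ‖h i‖ ^ 2) fun s _ => ?_
        have h1 := perturbed_add_le (hi := hi) (z := z) hC ht (l := l) (δ := δ) (p := p) (u := u)
          (h := h) (s := s) (c := fun i => 7 * l * ‖h i‖ ^ 2) (fun i => by
            have := (hD i).hi_le_add hl (u i) (u i + s • h i)
            rw [add_sub_cancel_left, real_inner_smul_right, norm_smul, mul_pow, Real.norm_eq_abs,
              sq_abs] at this
            linarith)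
        have h2 : ∑ i, inner ℝ (perturbedGrad z C t l δ u i - p i) (h i) = -∑ i, ‖h i‖ ^ 2 := by
          rw [← Finset.sum_neg_distrib]
          refine Finset.sum_congr rfl fun i _ => ?_
          rw [← neg_sub, inner_neg_left, real_inner_self_eq_norm_sq]
        rw [h2] at h1
        have h3 := hu (fun i => u i + s • h i)
        linarith
      have h0 : ‖h‖ ^ 2 ≤ 0 := (sq_norm_le_sum h).trans key
      have h1 : h = 0 := by simpa using h0
      ext1 i
      have := congrFun h1 i
      exact (sub_eq_zero.1 this).symm
    refine ⟨u, ⟨?_, p, hgrad, hu⟩, hgrad⟩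
    have h1 := (perturbed_ge hcoup hδ p u).trans ((hu 0).trans_eq (hF0 p))
    rw [← hN] at h1
    have h2 : ‖p‖ ^ 2 ≤ (δ ^ 2 / (2 * (N + 1))) ^ 2 :=
      pow_le_pow_left₀ (norm_nonneg _) hp'.le 2
    have h3 : N * ‖p‖ ^ 2 / δ < δ / 4 * δ ^ 2 := by
      rw [div_lt_iff₀ hδ]
      have h4 : N * ‖p‖ ^ 2 ≤ N * (δ ^ 2 / (2 * (N + 1))) ^ 2 := mul_le_mul_of_nonneg_left h2 hN0
      have h5 : N * (δ ^ 2 / (2 * (N + 1))) ^ 2 = δ / 4 * δ ^ 2 * δ * (N / (N + 1) ^ 2) := by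
        field_simp; ring
      have h6 : N / (N + 1) ^ 2 < 1 := by
        rw [div_lt_one (by positivity)]; nlinarith
      have h7 : δ / 4 * δ ^ 2 * δ * (N / (N + 1) ^ 2) < δ / 4 * δ ^ 2 * δ * 1 :=
        mul_lt_mul_of_pos_left h6 (by positivity)
      linarith
    have h4 : ‖u‖ ^ 2 < δ ^ 2 := lt_of_mul_lt_mul_left (by linarith) (by positivity : 0 ≤ δ / 4)
    exact lt_of_pow_lt_pow_left₀ 2 hδ.le h4
  obtain ⟨u, ⟨huδ, p, hup, hmin⟩, hdiff⟩ :=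
    exists_mem_differentiableAt_of_ball_subset_image hK hZ (by positivity) hsub
  have hdi : ∀ i, DifferentiableAt ℝ (fun y => (2 * l) • (z i y - y)) (u i) := by
    intro i
    have h1 : DifferentiableAt ℝ (fun w : ι → E => z i (w i)) u := differentiableAt_pi.1 hdiff i
    -- Restricting to the $i$-th slice through $u$ recovers differentiability of `z i` itself.
    have h2 : DifferentiableAt ℝ (fun y : E => Function.update u i y) (u i) :=
      (hasFDerivAt_update u (u i)).differentiableAt
    have h3 : DifferentiableAt ℝ (z i) (u i) := by
      have h4 := DifferentiableAt.comp (u i) (f := fun y : E => Function.update u i y)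
        (g := fun w : ι → E => z i (w i)) (by simpa using h1) h2
      simpa [Function.comp_def] using h4
    fun_prop
  refine ⟨u, fun i => fderiv ℝ (fun y => (2 * l) • (z i y - y)) (u i), huδ,
    fun i => (hdi i).hasFDerivAt, fun h => ?_⟩
  set X := fun i => fderiv ℝ (fun y => (2 * l) • (z i y - y)) (u i) with hX
  set c0 := ∑ i, t i * inner ℝ (X i (h i)) (h i) with hc0
  refine le_of_forall_pos_le_add_mul (c := 2 * ∑ i, t i * ‖h i‖ ^ 2) fun η hη => ?_
  have hlim : ∀ i, Tendsto (fun s : ℝ => u i + s • h i) (𝓝[>] 0) (𝓝 (u i)) := fun i => by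
    have : Continuous (fun s : ℝ => u i + s • h i) := by fun_prop
    simpa using (this.tendsto 0).mono_left nhdsWithin_le_nhds
  have hev := eventually_all.2 fun i => (hlim i).eventually
    (taylor_two_of_hasFDerivAt_gradient (fun y => (hD i).hasFDerivAt hl y)
      (hdi i).hasFDerivAt hη)
  obtain ⟨s, hs, hs0⟩ := (hev.and self_mem_nhdsWithin).exists
  have hs0' : 0 < s := hs0
  have h1 := perturbed_add_le (hi := hi) (z := z) hC ht (l := l) (δ := δ) (p := p) (u := u)
    (h := h) (s := s) (c := fun i => (1 / 2) * inner ℝ (X i (h i)) (h i) + η * ‖h i‖ ^ 2)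
    (fun i => by
      have h2 := (abs_le.1 (hs i)).2
      simp only [add_sub_cancel_left, norm_smul, mul_pow, Real.norm_eq_abs, sq_abs, map_smul,
        real_inner_smul_right, real_inner_smul_left] at h2
      simp only [hX, real_inner_smul_left]
      linarith)
  have h2 := hmin (fun i => u i + s • h i)
  have h3 : ∑ i, t i * ((1 / 2) * inner ℝ (X i (h i)) (h i) + η * ‖h i‖ ^ 2)
      = (1 / 2) * c0 + η * ∑ i, t i * ‖h i‖ ^ 2 := by
    rw [hc0, Finset.mul_sum, Finset.mul_sum, ← Finset.sum_add_distrib]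
    exact Finset.sum_congr rfl fun i _ => by ring
  rw [h3] at h1
  -- The first order term vanishes at the minimizer, leaving the sign of the second order one.
  simp only [hup, sub_self, inner_zero_left, Finset.sum_const_zero, mul_zero, add_zero] at h1
  have h4 : 0 ≤ s ^ 2 * ((1 / 2) * c0 + η * ∑ i, t i * ‖h i‖ ^ 2 - (1 / 2) * coupling C t h
      + δ / 2 * ∑ i, ‖h i‖ ^ 2) := by linarith
  have h5 := nonneg_of_mul_nonneg_right h4 (by positivity)
  linarith

end Jensen

/-! ### Transfer of the jets to the original functions -/

/-- A quadratic form bounded above to second order by a function with an upper quadratic bound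
satisfies the same bound. -/
theorem inner_le_of_taylor_le {f : E → ℝ} {u b : E} {X : E →L[ℝ] E} {l : ℝ}
    (hT : ∀ η : ℝ, 0 < η → ∀ᶠ y in 𝓝 u,
      f u + inner ℝ b (y - u) + (1 / 2) * inner ℝ (X (y - u)) (y - u) - η * ‖y - u‖ ^ 2 ≤ f y)
    (hf : ∀ k, f (u + k) ≤ f u + inner ℝ b k + l * ‖k‖ ^ 2) (k : E) :
    inner ℝ (X k) k ≤ 2 * l * ‖k‖ ^ 2 := by
  refine le_of_forall_pos_le_add_mul (c := 2 * ‖k‖ ^ 2) fun η hη => ?_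
  have hlim : Tendsto (fun s : ℝ => u + s • k) (𝓝[>] 0) (𝓝 u) := by
    have : Continuous (fun s : ℝ => u + s • k) := by fun_prop
    simpa using (this.tendsto 0).mono_left nhdsWithin_le_nhds
  obtain ⟨s, hs, hs0⟩ := ((hlim.eventually (hT η hη)).and self_mem_nhdsWithin).exists
  have hs0' : 0 < s := hs0
  have h1 := hf (s • k)
  simp only [add_sub_cancel_left, norm_smul, mul_pow, Real.norm_eq_abs, sq_abs, map_smul,
    real_inner_smul_right, real_inner_smul_left] at hs h1
  have h2 : s ^ 2 * inner ℝ (X k) k ≤ s ^ 2 * (2 * l * ‖k‖ ^ 2 + η * (2 * ‖k‖ ^ 2)) := by linarith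
  exact le_of_mul_le_mul_left h2 (by positivity)

/-- An approximate form of the theorem on sums: if `∑ i, t i * g i (y i)` dominates, up to a
quadratic penalization, a quadratic form in `∑ i, t i • u i`, then there are second order subjets
of the `g i` near the origin whose weighted sum almost dominates this form. -/
theorem exists_approx_subjets [FiniteDimensional ℝ E] {ι : Type*} [Fintype ι] {g : ι → E → ℝ}
    {r l : ℝ} {t : ι → ℝ} {C : E →L[ℝ] E} (hr : 0 < r) (ht : ∀ i, 0 < t i)
    (ht_sum : ∑ i, t i = 1) (hC : ∀ v w, inner ℝ (C v) w = inner ℝ (C w) v) (hCl : ‖C‖ < l)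
    (hg : ∀ i, ContinuousOn (g i) (closedBall 0 r)) (h0 : ∀ i, g i 0 = 0)
    (hcoup : ∀ y u : ι → E, (∀ i, y i ∈ closedBall (0 : E) r) →
      (1 / 2) * coupling C t u ≤ ∑ i, t i * (g i (y i) + l / 2 * ‖y i - u i‖ ^ 2))
    {δ : ℝ} (hδ : 0 < δ) :
    ∃ (a p : ι → E) (X : ι → E →L[ℝ] E), (∀ i, ‖a i‖ < δ) ∧ (∀ i, ‖p i‖ < δ) ∧
      (∀ i v w, inner ℝ (X i v) w = inner ℝ (X i w) v) ∧
      (∀ i, ∀ η : ℝ, 0 < η → ∀ᶠ y in 𝓝 (a i), g i (a i) + inner ℝ (p i) (y - a i)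
        + (1 / 2) * inner ℝ (X i (y - a i)) (y - a i) - η * ‖y - a i‖ ^ 2 ≤ g i y) ∧
      (∀ i k, |inner ℝ (X i k) k| ≤ 2 * l * ‖k‖ ^ 2) ∧
      ∀ h : ι → E, coupling C t h - δ * ∑ i, ‖h i‖ ^ 2 ≤ ∑ i, t i * inner ℝ (X i (h i)) (h i) := by
  classical
  have hl : 0 < l := (norm_nonneg _).trans_lt hCl
  have hex := fun i => exists_doubleConv hr.le hl (hg i)
  choose lo hi a z hD using hex
  -- At $u=0$ the domination gives $\sum t_j\,$`lo j 0` $\ge0$, while each `lo j 0` $\le0$.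
  have hlo0 : ∀ i, 0 ≤ lo i 0 := by
    intro i
    have h1 : ∀ j, lo j 0 ≤ 0 := fun j => by
      simpa [h0] using (hD j).lo_le 0 (mem_closedBall_self hr.le) 0
    have h2 := hcoup (fun j => a j 0) 0 fun j => (hD j).a_mem 0
    have h3 : (1 / 2) * coupling C t (0 : ι → E) = 0 := by simp [coupling]
    rw [h3] at h2
    have h4 : ∀ j, t j * (g j (a j 0) + l / 2 * ‖a j 0 - (0 : ι → E) j‖ ^ 2) = t j * lo j 0 :=
      fun j => by rw [(hD j).lo_eq]; rfl
    simp only [h4] at h2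
    have h5 : t i * lo i 0 = ∑ j, t j * lo j 0 - ∑ j ∈ Finset.univ.erase i, t j * lo j 0 := by
      rw [← Finset.add_sum_erase _ _ (Finset.mem_univ i)]; ring
    have h6 : ∑ j ∈ Finset.univ.erase i, t j * lo j 0 ≤ 0 :=
      Finset.sum_nonpos fun j _ => mul_nonpos_of_nonneg_of_nonpos (ht j).le (h1 j)
    have h7 : 0 ≤ t i * lo i 0 := by linarith
    exact nonneg_of_mul_nonneg_right h7 (ht i)
  have hcoup' : ∀ u, (1 / 2) * coupling C t u ≤ ∑ i, t i * hi i (u i) := by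
    intro u
    refine (hcoup (fun i => a i (u i)) u fun i => (hD i).a_mem _).trans ?_
    refine Finset.sum_le_sum fun i _ => mul_le_mul_of_nonneg_left ?_ (ht i).le
    rw [← (hD i).lo_eq]
    exact (hD i).lo_le_hi _
  -- The bounds serve $|a|\le6|u|$, the gradient bound $2l\cdot5|u|$, keeping $a$ inside the ball,
  -- and the lower Hessian bound.
  obtain ⟨d, hd0, hdδ, hd6, hdl, hdr, hdt⟩ : ∃ d : ℝ, 0 < d ∧ d < δ ∧ d < δ / 6 ∧ d < δ / (10 * l) ∧
      d < r / 6 ∧ ∀ i, d < t i * l := by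
    have e : ∀ c : ℝ, 0 < c → ∀ᶠ d in 𝓝[>] (0 : ℝ), d < c := fun c hc => by
      filter_upwards [Ioo_mem_nhdsGT hc] with d hd using hd.2
    exact (eventually_mem_nhdsWithin.and <| (e _ hδ).and <| (e _ (by positivity)).and <|
      (e _ (by positivity)).and <| (e _ (by positivity)).and <|
      eventually_all.2 fun i => e _ (mul_pos (ht i) hl)).exists
  obtain ⟨u, X, hu, hX, hH⟩ := exists_hessian_ge hD hl (fun i => (ht i).le) ht_sum hC hcoup'
    (fun i => (hD i).hi_zero hr.le hl (h0 i) (hlo0 i)) hd0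
  have hui : ∀ i, ‖u i‖ < d := fun i => (norm_le_pi_norm u i).trans_lt hu
  have hT : ∀ i, ∀ η : ℝ, 0 < η → ∀ᶠ y in 𝓝 (u i), hi i (u i)
      + inner ℝ ((2 * l) • (z i (u i) - u i)) (y - u i)
      + (1 / 2) * inner ℝ (X i (y - u i)) (y - u i) - η * ‖y - u i‖ ^ 2 ≤ hi i y := by
    intro i η hη
    filter_upwards [taylor_two_of_hasFDerivAt_gradient (fun y => (hD i).hasFDerivAt hl y) (hX i)
      hη] with y hy
    linarith [(abs_le.1 hy).1]
  -- Test the block inequality on vectors with one nonzero component.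
  have hlow : ∀ i k, -(‖C‖ + l) * ‖k‖ ^ 2 ≤ inner ℝ (X i k) k := by
    intro i k
    have h1 := hH (Pi.single i k)
    have ht1 : t i ≤ 1 :=
      ht_sum ▸ Finset.single_le_sum (f := t) (fun i _ => (ht i).le) (Finset.mem_univ i)
    have s1 : ∑ j, t j • (Pi.single i k : ι → E) j = t i • k := by
      rw [Finset.sum_eq_single i (fun j _ hj => by simp [Pi.single_eq_of_ne hj]) (by simp)]
      simp
    have s2 : ∑ j, ‖(Pi.single i k : ι → E) j‖ ^ 2 = ‖k‖ ^ 2 := by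
      rw [Finset.sum_eq_single i (fun j _ hj => by simp [Pi.single_eq_of_ne hj]) (by simp)]
      simp
    have s3 : ∑ j, t j * inner ℝ (X j ((Pi.single i k : ι → E) j)) ((Pi.single i k : ι → E) j)
        = t i * inner ℝ (X i k) k := by
      rw [Finset.sum_eq_single i (fun j _ hj => by simp [Pi.single_eq_of_ne hj]) (by simp)]
      simp
    rw [s2, s3, coupling, s1, map_smul, real_inner_smul_left, real_inner_smul_right] at h1
    have h2 : -(‖C‖ * ‖k‖ ^ 2) ≤ inner ℝ (C k) k := by
      have e1 := abs_real_inner_le_norm (C k) k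
      have e2 := mul_le_mul_of_nonneg_right (C.le_opNorm k) (norm_nonneg k)
      have e3 := neg_abs_le (inner ℝ (C k) k)
      nlinarith
    have h3 : 0 ≤ ‖k‖ ^ 2 := by positivity
    have h4 : d * ‖k‖ ^ 2 ≤ t i * l * ‖k‖ ^ 2 := mul_le_mul_of_nonneg_right (hdt i).le h3
    have h5 : t i * (t i * -(‖C‖ * ‖k‖ ^ 2)) ≤ t i * (t i * inner ℝ (C k) k) := by
      have := (ht i).le; gcongr
    have h6 : t i * (‖C‖ * ‖k‖ ^ 2) ≤ ‖C‖ * ‖k‖ ^ 2 :=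
      mul_le_of_le_one_left (by positivity) ht1
    refine le_of_mul_le_mul_left ?_ (ht i)
    have h7 := mul_le_mul_of_nonneg_left h6 (ht i).le
    linarith
  have hmid : ∀ i, u i = (1 / 2 : ℝ) • (z i (u i) + a i (z i (u i))) := by
    intro i
    -- As $\|C\|<l$, the bound $\|C\|+l$ is below $2l$; half of the gap absorbs the Taylor error.
    refine (hD i).eq_midpoint hl (u i) (M := (‖C‖ + l) + (l - ‖C‖) / 2) (by linarith) ?_
    filter_upwards [hT i ((l - ‖C‖) / 4) (by linarith)] with y hy
    have := hlow i (y - u i)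
    nlinarith
  have hz : ∀ i, ‖z i (u i)‖ ≤ 4 * ‖u i‖ := fun i =>
    (hD i).norm_z_le hr.le hl (h0 i) (hlo0 i) (u i)
  have ha : ∀ i, ‖a i (z i (u i))‖ ≤ 6 * ‖u i‖ := by
    intro i
    rw [eq_two_smul_sub_of_eq_midpoint (hmid i)]
    refine (norm_sub_le _ _).trans ?_
    rw [norm_smul]
    norm_num
    linarith [hz i]
  refine ⟨fun i => a i (z i (u i)), fun i => (2 * l) • (z i (u i) - u i), X,
    fun i => by linarith [ha i, hui i], fun i => ?_,
    fun i => inner_symm_of_hasFDerivAt (fun y => (hD i).hasFDerivAt hl y) (hX i),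
    fun i η hη => ?_,
    fun i k => abs_le.2 ⟨?_, inner_le_of_taylor_le (hT i)
      ((hD i).hi_le_hi_add_of_eq_midpoint hl (hmid i)) k⟩,
    fun h => ?_⟩
  · rw [norm_smul, Real.norm_of_nonneg (by positivity)]
    have h1 := norm_sub_le (z i (u i)) (u i)
    have h2 := hui i
    rw [lt_div_iff₀ (by positivity)] at hdl
    nlinarith [hz i]
  · have hin : ∀ᶠ y in 𝓝 (a i (z i (u i))), y ∈ closedBall (0 : E) r := by
      have : a i (z i (u i)) ∈ ball (0 : E) r := by
        rw [mem_ball_zero_iff]; linarith [ha i, hui i]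
      filter_upwards [isOpen_ball.mem_nhds this] with y hy using ball_subset_closedBall hy
    have hlim : Tendsto (fun y => u i + (y - a i (z i (u i)))) (𝓝 (a i (z i (u i))))
        (𝓝 (u i)) := by
      have : Continuous (fun y => u i + (y - a i (z i (u i)))) := by fun_prop
      simpa using this.tendsto (a i (z i (u i)))
    filter_upwards [hin, hlim.eventually (hT i η hη)] with y hy1 hy2
    have h1 := (hD i).hi_sub_le hl (hmid i) (k := y - a i (z i (u i)))
      (by rwa [add_sub_cancel])
    rw [add_sub_cancel] at h1
    rw [add_sub_cancel_left] at hy2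
    linarith
  · have := hlow i k
    nlinarith [sq_nonneg ‖k‖]
  · refine le_trans ?_ (hH h)
    have : 0 ≤ ∑ i, ‖h i‖ ^ 2 := Finset.sum_nonneg fun i _ => by positivity
    nlinarith

/-! ### Completing the square and passing to the limit -/

theorem norm_sum_smul_sq_le {ι : Type*} [Fintype ι] {t : ι → ℝ} (ht : ∀ i, 0 ≤ t i)
    (ht_sum : ∑ i, t i = 1) (y : ι → E) : ‖∑ i, t i • y i‖ ^ 2 ≤ ∑ i, t i * ‖y i‖ ^ 2 := by
  set c := ∑ i, t i • y i with hc
  have h1 : 0 ≤ ∑ i, t i * ‖y i - c‖ ^ 2 :=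
    Finset.sum_nonneg fun i _ => mul_nonneg (ht i) (by positivity)
  have h2 : ∑ i, t i * ‖y i - c‖ ^ 2
      = ∑ i, t i * ‖y i‖ ^ 2 - 2 * inner ℝ c c + (∑ i, t i) * ‖c‖ ^ 2 := by
    nth_rewrite 2 [hc]
    rw [sum_inner, Finset.mul_sum, Finset.sum_mul, ← Finset.sum_sub_distrib,
      ← Finset.sum_add_distrib]
    refine Finset.sum_congr rfl fun i _ => ?_
    rw [norm_sub_sq_real, real_inner_smul_left]
    ring
  rw [ht_sum, real_inner_self_eq_norm_sq] at h2
  linarith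

/-- Write $Ty=b+c$ with $b=Tu$. The cross term obeys $2\langle
Ab,c\rangle\ge-\varepsilon|Ab|^2-|c|^2/\varepsilon$, the source of $-\varepsilon A^2$; convexity
bounds $|c|^2$ by $\sum t_i|y_i-u_i|^2$. -/
theorem coupling_le_of_le {ι : Type*} [Fintype ι] {t : ι → ℝ} (ht : ∀ i, 0 ≤ t i)
    (ht_sum : ∑ i, t i = 1) {A : E →L[ℝ] E} (hA : ∀ v w, inner ℝ (A v) w = inner ℝ (A w) v)
    {ε η l : ℝ} (hε : 0 < ε) (hη : 0 ≤ η) (hl : 1 / ε + ‖A‖ + 2 * η ≤ l) (y u : ι → E) :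
    coupling (A - ε • A.comp A - (2 * η) • ContinuousLinearMap.id ℝ E) t u ≤
      coupling A t y - η * ‖∑ i, t i • y i‖ ^ 2 + l * ∑ i, t i * ‖y i - u i‖ ^ 2 := by
  obtain ⟨b, hb⟩ : ∃ b : E, b = ∑ i, t i • u i := ⟨_, rfl⟩
  obtain ⟨c, hc⟩ : ∃ c : E, c = ∑ i, t i • (y i - u i) := ⟨_, rfl⟩
  have hy : ∑ i, t i • y i = b + c := by
    rw [hb, hc, ← Finset.sum_add_distrib]
    exact Finset.sum_congr rfl fun i _ => by module
  have h1 : ‖c‖ ^ 2 ≤ ∑ i, t i * ‖y i - u i‖ ^ 2 := hc ▸ norm_sum_smul_sq_le ht ht_sum _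
  have h2 : -(‖A‖ * ‖c‖ ^ 2) ≤ inner ℝ (A c) c := by
    have e1 := abs_real_inner_le_norm (A c) c
    have e2 := mul_le_mul_of_nonneg_right (A.le_opNorm c) (norm_nonneg c)
    have e3 := neg_abs_le (inner ℝ (A c) c)
    nlinarith
  have h3 : -(ε * ‖A b‖ ^ 2) - 1 / ε * ‖c‖ ^ 2 ≤ 2 * inner ℝ (A b) c := by
    have e1 : 0 ≤ 1 / ε * ‖ε • A b + c‖ ^ 2 := by positivity
    have e2 : 1 / ε * ‖ε • A b + c‖ ^ 2
        = ε * ‖A b‖ ^ 2 + 2 * inner ℝ (A b) c + 1 / ε * ‖c‖ ^ 2 := by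
      rw [norm_add_sq_real, real_inner_smul_left, norm_smul, mul_pow, Real.norm_eq_abs, sq_abs]
      field_simp
    linarith
  have h4 : ‖b + c‖ ^ 2 ≤ 2 * ‖b‖ ^ 2 + 2 * ‖c‖ ^ 2 := by
    have := parallelogram_law_with_norm ℝ b c
    nlinarith [norm_nonneg (b - c)]
  have h5 : l * ‖c‖ ^ 2 ≤ l * ∑ i, t i * ‖y i - u i‖ ^ 2 := by
    refine mul_le_mul_of_nonneg_left h1 (le_trans ?_ hl)
    positivity
  have h6 : (1 / ε + ‖A‖ + 2 * η) * ‖c‖ ^ 2 ≤ l * ‖c‖ ^ 2 :=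
    mul_le_mul_of_nonneg_right hl (by positivity)
  have h7 : η * ‖b + c‖ ^ 2 ≤ η * (2 * ‖b‖ ^ 2 + 2 * ‖c‖ ^ 2) := mul_le_mul_of_nonneg_left h4 hη
  unfold coupling
  rw [hy, ← hb]
  simp only [sub_apply, smul_apply, ContinuousLinearMap.comp_apply, ContinuousLinearMap.id_apply,
    map_add, inner_sub_left, inner_add_left, inner_add_right, real_inner_smul_left,
    real_inner_self_eq_norm_sq, hA (A b) b, hA c b]
  linarith

/-- Polarize with $w=Xv/(2l)$. -/
theorem opNorm_le_of_abs_inner_le {X : E →L[ℝ] E} {l : ℝ} (hl : 0 < l)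
    (hX : ∀ v w, inner ℝ (X v) w = inner ℝ (X w) v)
    (h : ∀ k, |inner ℝ (X k) k| ≤ 2 * l * ‖k‖ ^ 2) : ‖X‖ ≤ 2 * l := by
  refine X.opNorm_le_bound (by positivity) fun v => ?_
  obtain ⟨w, hw⟩ : ∃ w : E, w = (1 / (2 * l)) • X v := ⟨_, rfl⟩
  have h1 := (abs_le.1 (h (v + w))).2
  have h2 := (abs_le.1 (h (v - w))).1
  have h3 := parallelogram_law_with_norm ℝ v w
  have h4 : inner ℝ (X (v + w)) (v + w) - inner ℝ (X (v - w)) (v - w) = 4 * inner ℝ (X v) w := by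
    simp only [map_add, map_sub, inner_add_left, inner_add_right, inner_sub_left, inner_sub_right,
      hX w v]
    ring
  have h5 : 2 * l * ‖v + w‖ ^ 2 + 2 * l * ‖v - w‖ ^ 2 = 4 * l * (‖v‖ ^ 2 + ‖w‖ ^ 2) := by
    linear_combination 2 * l * h3
  have h6 : inner ℝ (X v) w ≤ l * (‖v‖ ^ 2 + ‖w‖ ^ 2) := by linarith
  have h7 : X v = (2 * l) • w := by rw [hw, smul_smul]; field_simp; simp
  rw [h7, real_inner_smul_left, real_inner_self_eq_norm_sq] at h6
  have h8 : ‖w‖ ^ 2 ≤ ‖v‖ ^ 2 := by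
    refine le_of_mul_le_mul_left ?_ hl
    linarith
  rw [h7, norm_smul, Real.norm_of_nonneg (by positivity)]
  exact mul_le_mul_of_nonneg_left (le_of_sq_le_sq h8 (norm_nonneg _)) (by positivity)

/-- The theorem on sums: if `∑ i, t i * g i (y i)` dominates to second order at the origin the
quadratic form of `A` in `∑ i, t i • y i`, then there are limits `X i` of second order subjets of
`g i` near the origin whose weighted sum dominates the quadratic form of `A - ε • A ^ 2`. -/
theorem exists_limit_subjets [FiniteDimensional ℝ E] {ι : Type*} [Fintype ι] {g : ι → E → ℝ}
    {R : ℝ} {t : ι → ℝ} {A : E →L[ℝ] E} (hR : 0 < R) (ht : ∀ i, 0 < t i)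
    (ht_sum : ∑ i, t i = 1) (hA : ∀ v w, inner ℝ (A v) w = inner ℝ (A w) v)
    (hg : ∀ i, ContinuousOn (g i) (closedBall 0 R)) (h0 : ∀ i, g i 0 = 0)
    (hge : ∀ η : ℝ, 0 < η → ∀ᶠ y in 𝓝 (0 : ι → E),
      (1 / 2) * coupling A t y - η * ‖∑ i, t i • y i‖ ^ 2 ≤ ∑ i, t i * g i (y i))
    {ε : ℝ} (hε : 0 < ε) :
    ∃ (a p : ℕ → ι → E) (Y : ℕ → ι → E →L[ℝ] E) (X : ι → E →L[ℝ] E),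
      (∀ m i, ‖a m i‖ < R) ∧ Tendsto a atTop (𝓝 0) ∧ Tendsto p atTop (𝓝 0) ∧
      Tendsto Y atTop (𝓝 X) ∧ (∀ m i v w, inner ℝ (Y m i v) w = inner ℝ (Y m i w) v) ∧
      (∀ m i, ∀ η : ℝ, 0 < η → ∀ᶠ y in 𝓝 (a m i),
        g i (a m i) + inner ℝ (p m i) (y - a m i)
          + (1 / 2) * inner ℝ (Y m i (y - a m i)) (y - a m i) - η * ‖y - a m i‖ ^ 2 ≤ g i y) ∧
      ∀ h : ι → E, coupling (A - ε • A.comp A) t h ≤ ∑ i, t i * inner ℝ (X i (h i)) (h i) := by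
  set C : E →L[ℝ] E := A - ε • A.comp A with hCdef
  -- One $l$ serves all $m$, since $\eta\le1$; the Hessian bound $2l$ is therefore uniform.
  obtain ⟨l, hl1, hl2⟩ : ∃ l, 1 / ε + ‖A‖ + 2 ≤ l ∧ ‖C‖ + 2 < l :=
    ⟨max (1 / ε + ‖A‖ + 2) (‖C‖ + 3), le_max_left _ _, lt_of_lt_of_le (by linarith)
      (le_max_right _ _)⟩
  have hl : 0 < l := lt_of_le_of_lt (by positivity) hl2
  have key : ∀ m : ℕ, ∃ (a p : ι → E) (X : ι → E →L[ℝ] E),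
      (∀ i, ‖a i‖ < R) ∧ (∀ i, ‖a i‖ < 1 / ((m : ℝ) + 1)) ∧ (∀ i, ‖p i‖ < 1 / ((m : ℝ) + 1)) ∧
      (∀ i v w, inner ℝ (X i v) w = inner ℝ (X i w) v) ∧
      (∀ i, ∀ η : ℝ, 0 < η → ∀ᶠ y in 𝓝 (a i), g i (a i) + inner ℝ (p i) (y - a i)
        + (1 / 2) * inner ℝ (X i (y - a i)) (y - a i) - η * ‖y - a i‖ ^ 2 ≤ g i y) ∧
      (∀ i, ‖X i‖ ≤ 2 * l) ∧
      ∀ h : ι → E, coupling C t h - 1 / ((m : ℝ) + 1) * (2 * ‖∑ i, t i • h i‖ ^ 2 + ∑ i, ‖h i‖ ^ 2)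
        ≤ ∑ i, t i * inner ℝ (X i (h i)) (h i) := by
    intro m
    set η : ℝ := 1 / ((m : ℝ) + 1) with hη
    have hη0 : 0 < η := by positivity
    have hη1 : η ≤ 1 := by
      rw [hη, div_le_one (by positivity)]
      linarith [(Nat.cast_nonneg m : (0 : ℝ) ≤ m)]
    obtain ⟨ρ, hρ, hball⟩ := Metric.eventually_nhds_iff_ball.1 (hge (η / 2) (by positivity))
    set r := min (ρ / 2) R with hr
    have hr0 : 0 < r := lt_min (by positivity) hR
    set D : E →L[ℝ] E := C - (2 * η) • ContinuousLinearMap.id ℝ E with hD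
    have hDsymm : ∀ v w, inner ℝ (D v) w = inner ℝ (D w) v := by
      intro v w
      simp only [hD, hCdef, sub_apply, smul_apply, ContinuousLinearMap.comp_apply,
        ContinuousLinearMap.id_apply, inner_sub_left, real_inner_smul_left, hA (A v) w,
        hA (A w) v, hA v w, real_inner_comm v w, real_inner_comm (A v) (A w)]
    have hDl : ‖D‖ < l := by
      have e1 := norm_sub_le C ((2 * η) • ContinuousLinearMap.id ℝ E)
      have e2 : ‖(2 * η) • ContinuousLinearMap.id ℝ E‖ ≤ 2 := by
        rw [norm_smul, Real.norm_of_nonneg (by positivity)]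
        nlinarith [ContinuousLinearMap.norm_id_le (𝕜 := ℝ) (E := E)]
      linarith
    have hcoup : ∀ y u : ι → E, (∀ i, y i ∈ closedBall (0 : E) r) →
        (1 / 2) * coupling D t u ≤ ∑ i, t i * (g i (y i) + l / 2 * ‖y i - u i‖ ^ 2) := by
      intro y u hy
      have e1 : y ∈ ball (0 : ι → E) ρ := by
        rw [mem_ball_zero_iff]
        refine lt_of_le_of_lt ((pi_norm_le_iff_of_nonneg hr0.le).2 fun i => by simpa using hy i) ?_
        exact (min_le_left _ _).trans_lt (by linarith)
      have e2 := hball y e1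
      have e3 := coupling_le_of_le (fun i => (ht i).le) ht_sum hA hε hη0.le
        (show 1 / ε + ‖A‖ + 2 * η ≤ l by linarith) y u
      have e4 : ∑ i, t i * (g i (y i) + l / 2 * ‖y i - u i‖ ^ 2)
          = ∑ i, t i * g i (y i) + l / 2 * ∑ i, t i * ‖y i - u i‖ ^ 2 := by
        rw [Finset.mul_sum, ← Finset.sum_add_distrib]
        exact Finset.sum_congr rfl fun i _ => by ring
      rw [e4]
      linarith
    obtain ⟨a, p, X, ha, hp, hXs, hXt, hXb, hXc⟩ := exists_approx_subjets hr0 ht ht_sum hDsymm hDl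
      (fun i => (hg i).mono (closedBall_subset_closedBall (min_le_right _ _))) h0 hcoup
      (lt_min hη0 hR)
    refine ⟨a, p, X, fun i => (ha i).trans_le (min_le_right _ _),
      fun i => (ha i).trans_le (min_le_left _ _), fun i => (hp i).trans_le (min_le_left _ _),
      hXs, hXt, fun i => opNorm_le_of_abs_inner_le hl (hXs i) (hXb i), fun h => ?_⟩
    refine le_trans ?_ (hXc h)
    have e1 : coupling D t h = coupling C t h - 2 * η * ‖∑ i, t i • h i‖ ^ 2 := by
      simp only [coupling, hD, sub_apply, smul_apply, ContinuousLinearMap.id_apply,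
        inner_sub_left, real_inner_smul_left, real_inner_self_eq_norm_sq]
    have e2 : 0 ≤ ∑ i, ‖h i‖ ^ 2 := Finset.sum_nonneg fun i _ => by positivity
    have e3 := mul_le_mul_of_nonneg_right (min_le_left η R) e2
    rw [e1]
    linarith
  choose a p Y haR ha hp hYs hYt hYb hYc using key
  have hprop : ProperSpace (E →L[ℝ] E) := FiniteDimensional.proper ℝ _
  have hmem : ∀ m, Y m ∈ closedBall (0 : ι → E →L[ℝ] E) (2 * l) := fun m => by
    rw [mem_closedBall_zero_iff]
    exact (pi_norm_le_iff_of_nonneg (by positivity)).2 (hYb m)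
  obtain ⟨X, -, φ, hφ, hlim⟩ := (isCompact_closedBall _ _).tendsto_subseq hmem
  have hone : Tendsto (fun m : ℕ => 1 / ((m : ℝ) + 1)) atTop (𝓝 0) :=
    tendsto_one_div_add_atTop_nhds_zero_nat
  have hsmall : ∀ q : ℕ → ι → E, (∀ m i, ‖q m i‖ < 1 / ((m : ℝ) + 1)) → Tendsto q atTop (𝓝 0) :=
    fun q hq => squeeze_zero_norm
      (fun m => (pi_norm_le_iff_of_nonneg (by positivity)).2 fun i => (hq m i).le) hone
  refine ⟨a ∘ φ, p ∘ φ, Y ∘ φ, X, fun m i => haR _ i, (hsmall a ha).comp hφ.tendsto_atTop,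
    (hsmall p hp).comp hφ.tendsto_atTop, hlim, fun m => hYs _, fun m => hYt _, fun h => ?_⟩
  have l1 : Tendsto (fun m => coupling C t h - 1 / (((φ m : ℕ) : ℝ) + 1) *
      (2 * ‖∑ i, t i • h i‖ ^ 2 + ∑ i, ‖h i‖ ^ 2)) atTop (𝓝 (coupling C t h)) := by
    simpa using ((hone.comp hφ.tendsto_atTop).mul_const
      (2 * ‖∑ i, t i • h i‖ ^ 2 + ∑ i, ‖h i‖ ^ 2)).const_sub (coupling C t h)
  have l2 : Tendsto (fun m => ∑ i, t i * inner ℝ (Y (φ m) i (h i)) (h i)) atTop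
      (𝓝 (∑ i, t i * inner ℝ (X i (h i)) (h i))) := by
    have hcont : Continuous fun Z : ι → E →L[ℝ] E => ∑ i, t i * inner ℝ (Z i (h i)) (h i) := by
      fun_prop
    exact (hcont.tendsto X).comp hlim
  exact le_of_tendsto_of_tendsto' l1 l2 fun m => hYc (φ m) h

/-! ### Harmonic means of matrices -/

namespace Matrix

variable {ν ι : Type*} [Fintype ν] [DecidableEq ν] [Fintype ι]

theorem dotProduct_mulVec_comm_of_isSymm {ν : Type*} [Fintype ν] {B : Matrix ν ν ℝ}
    (hB : B.IsSymm) (v w : ν → ℝ) :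
    v ⬝ᵥ (B *ᵥ w) = w ⬝ᵥ (B *ᵥ v) := by
  rw [dotProduct_mulVec, ← mulVec_transpose, hB.eq, dotProduct_comm]

theorem PosDef.mulVec_inv_mulVec {P : Matrix ν ν ℝ} (hP : P.PosDef) (v : ν → ℝ) :
    P *ᵥ (P⁻¹ *ᵥ v) = v := by
  rw [mulVec_mulVec, mul_nonsing_inv _ ((isUnit_iff_isUnit_det _).1 hP.isUnit), one_mulVec]

theorem posDef_sum_smul_inv [Nonempty ι] {t : ι → ℝ} (ht : ∀ i, 0 < t i) {P : ι → Matrix ν ν ℝ}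
    (hP : ∀ i, (P i).PosDef) : (∑ i, t i • (P i)⁻¹).PosDef :=
  posDef_sum Finset.univ_nonempty fun i _ => (hP i).inv.smul (ht i)

/-- Expand $\sum t_i\langle P_i(h_i-P_i^{-1}k),h_i-P_i^{-1}k\rangle\ge0$ with $k=S^{-1}\sum t_ih_i$.
-/
theorem dotProduct_harmonic_le [Nonempty ι] {t : ι → ℝ} (ht : ∀ i, 0 < t i)
    {P : ι → Matrix ν ν ℝ} (hP : ∀ i, (P i).PosDef) (h : ι → ν → ℝ) :
    (∑ i, t i • h i) ⬝ᵥ ((∑ i, t i • (P i)⁻¹)⁻¹ *ᵥ ∑ i, t i • h i) ≤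
      ∑ i, t i * (h i ⬝ᵥ (P i *ᵥ h i)) := by
  set S := ∑ i, t i • (P i)⁻¹ with hS
  have hSp : S.PosDef := posDef_sum_smul_inv ht hP
  set k := S⁻¹ *ᵥ ∑ i, t i • h i with hk
  have hSk : S *ᵥ k = ∑ i, t i • h i := hSp.mulVec_inv_mulVec _
  have h1 : ∀ i, 0 ≤ t i * ((h i - (P i)⁻¹ *ᵥ k) ⬝ᵥ (P i *ᵥ (h i - (P i)⁻¹ *ᵥ k))) := fun i =>
    mul_nonneg (ht i).le (by
      simpa only [star_trivial] using (hP i).posSemidef.dotProduct_mulVec_nonneg _)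
  have h2 : ∀ i, t i * ((h i - (P i)⁻¹ *ᵥ k) ⬝ᵥ (P i *ᵥ (h i - (P i)⁻¹ *ᵥ k)))
      = t i * (h i ⬝ᵥ (P i *ᵥ h i)) - 2 * ((t i • h i) ⬝ᵥ k)
        + (t i • (P i)⁻¹) *ᵥ k ⬝ᵥ k := fun i => by
    have e1 : P i *ᵥ ((P i)⁻¹ *ᵥ k) = k := (hP i).mulVec_inv_mulVec k
    have e2 : ((P i)⁻¹ *ᵥ k) ⬝ᵥ (P i *ᵥ h i) = h i ⬝ᵥ k := by
      rw [dotProduct_mulVec_comm_of_isSymm (isHermitian_iff_isSymm.1 (hP i).isHermitian), e1]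
    rw [mulVec_sub, e1, sub_dotProduct, dotProduct_sub, dotProduct_sub, e2, smul_mulVec,
      smul_dotProduct, smul_dotProduct, smul_eq_mul, smul_eq_mul]
    ring
  have h3 := Finset.sum_nonneg fun i (_ : i ∈ Finset.univ) => h1 i
  simp only [h2, Finset.sum_add_distrib, Finset.sum_sub_distrib, ← Finset.mul_sum] at h3
  rw [← sum_dotProduct, ← sum_dotProduct, ← sum_mulVec, ← hS, hSk] at h3
  linarith

/-- The choice $h_i=P_i^{-1}k$ is the equality case of `dotProduct_harmonic_le`: the harmonic mean
is the largest form satisfying the block inequality. -/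
theorem dotProduct_le_harmonic [Nonempty ι] {t : ι → ℝ} (ht : ∀ i, 0 < t i)
    {P : ι → Matrix ν ν ℝ} (hP : ∀ i, (P i).PosDef) {C : Matrix ν ν ℝ}
    (hC : ∀ h : ι → ν → ℝ, (∑ i, t i • h i) ⬝ᵥ (C *ᵥ ∑ i, t i • h i) ≤
      ∑ i, t i * (h i ⬝ᵥ (P i *ᵥ h i))) (v : ν → ℝ) :
    v ⬝ᵥ (C *ᵥ v) ≤ v ⬝ᵥ ((∑ i, t i • (P i)⁻¹)⁻¹ *ᵥ v) := by
  set S := ∑ i, t i • (P i)⁻¹ with hS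
  have hSp : S.PosDef := posDef_sum_smul_inv ht hP
  set k := S⁻¹ *ᵥ v with hk
  have hSk : S *ᵥ k = v := hSp.mulVec_inv_mulVec _
  have h1 := hC fun i => (P i)⁻¹ *ᵥ k
  have e1 : ∑ i, t i • ((P i)⁻¹ *ᵥ k) = v := by
    rw [← hSk, hS, sum_mulVec]
    exact Finset.sum_congr rfl fun i _ => (smul_mulVec _ _ _).symm
  have e2 : ∑ i, t i * (((P i)⁻¹ *ᵥ k) ⬝ᵥ (P i *ᵥ ((P i)⁻¹ *ᵥ k))) = v ⬝ᵥ k := by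
    rw [← e1, sum_dotProduct]
    refine Finset.sum_congr rfl fun i _ => ?_
    rw [(hP i).mulVec_inv_mulVec, smul_dotProduct, smul_eq_mul]
  rwa [e1, e2] at h1

/-- A family of symmetric matrices whose quadratic forms are monotone and nonnegative on
`(0, ∞)` converges at `0`. -/
theorem exists_tendsto_of_monotoneOn {F : ℝ → Matrix ν ν ℝ} (hs : ∀ δ, 0 < δ → (F δ).IsSymm)
    (hmono : ∀ v, MonotoneOn (fun δ => v ⬝ᵥ (F δ *ᵥ v)) (Set.Ioi 0))
    (h0 : ∀ δ, 0 < δ → ∀ v, 0 ≤ v ⬝ᵥ (F δ *ᵥ v)) : ∃ H, Tendsto F (𝓝[>] 0) (𝓝 H) := by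
  have h1 : ∀ v : ν → ℝ, ∃ q : ℝ, Tendsto (fun δ => v ⬝ᵥ (F δ *ᵥ v)) (𝓝[>] 0) (𝓝 q) :=
    fun v => ⟨_, (hmono v).tendsto_nhdsGT ⟨0, by rintro _ ⟨δ, hδ, rfl⟩; exact h0 δ hδ v⟩⟩
  choose q hq using h1
  -- Entries are recovered by polarization.
  refine ⟨fun i j => (1 / 2) * (q (Pi.single i 1 + Pi.single j 1) - q (Pi.single i 1)
    - q (Pi.single j 1)), tendsto_pi_nhds.2 fun i => tendsto_pi_nhds.2 fun j => ?_⟩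
  refine Tendsto.congr' ?_ ((((hq (Pi.single i 1 + Pi.single j 1)).sub (hq (Pi.single i 1))).sub
    (hq (Pi.single j 1))).const_mul (1 / 2))
  filter_upwards [self_mem_nhdsWithin] with δ hδ
  have e1 : Pi.single i 1 ⬝ᵥ (F δ *ᵥ Pi.single j 1) = F δ i j := by simp
  have e2 := dotProduct_mulVec_comm_of_isSymm (hs δ hδ) (Pi.single i 1) (Pi.single j 1)
  rw [mulVec_add, add_dotProduct, dotProduct_add, dotProduct_add, ← e2, e1]
  ring

theorem posSemidef_sub_iff {ν : Type*} [Fintype ν] {B C : Matrix ν ν ℝ} (hB : B.IsSymm)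
    (hC : C.IsSymm) :
    (B - C).PosSemidef ↔ ∀ v, v ⬝ᵥ (C *ᵥ v) ≤ v ⬝ᵥ (B *ᵥ v) := by
  rw [posSemidef_iff_dotProduct_mulVec]
  simp only [star_trivial, sub_mulVec, dotProduct_sub, sub_nonneg, and_iff_right_iff_imp]
  exact fun _ => isHermitian_iff_isSymm.2 (hB.sub hC)

theorem posSemidef_iff_of_isSymm {ν : Type*} [Fintype ν] {B : Matrix ν ν ℝ} (hB : B.IsSymm) :
    B.PosSemidef ↔ ∀ v, 0 ≤ v ⬝ᵥ (B *ᵥ v) := by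
  simpa using posSemidef_sub_iff hB (isSymm_zero (n := ν) (α := ℝ))

theorem posSemidef_harmonic_sub [Nonempty ι] {t : ι → ℝ} (ht : ∀ i, 0 < t i)
    {P : ι → Matrix ν ν ℝ} (hP : ∀ i, (P i).PosDef) {C : Matrix ν ν ℝ} (hCs : C.IsSymm)
    (hC : ∀ h : ι → ν → ℝ, (∑ i, t i • h i) ⬝ᵥ (C *ᵥ ∑ i, t i • h i) ≤
      ∑ i, t i * (h i ⬝ᵥ (P i *ᵥ h i))) :
    ((∑ i, t i • (P i)⁻¹)⁻¹ - C).PosSemidef :=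
  (posSemidef_sub_iff (isHermitian_iff_isSymm.1 (posDef_sum_smul_inv ht hP).inv.isHermitian)
    hCs).2 (dotProduct_le_harmonic ht hP hC)

/-- By the extremal property the regularized means increase with $\delta$. Adding $\delta I$ only
weakens the block inequality, so each of them dominates $C$. -/
theorem exists_harmonicMean [Nonempty ι] {t : ι → ℝ} (ht : ∀ i, 0 < t i)
    {B : ι → Matrix ν ν ℝ} (hB : ∀ i, (B i).PosSemidef) {C : Matrix ν ν ℝ} (hCs : C.IsSymm)
    (hC : ∀ h : ι → ν → ℝ, (∑ i, t i • h i) ⬝ᵥ (C *ᵥ ∑ i, t i • h i) ≤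
      ∑ i, t i * (h i ⬝ᵥ (B i *ᵥ h i))) :
    ∃ H, Tendsto (fun δ : ℝ => (∑ i, t i • (B i + δ • (1 : Matrix ν ν ℝ))⁻¹)⁻¹) (𝓝[>] 0) (𝓝 H) ∧
      (H - C).PosSemidef := by
  have hP : ∀ δ : ℝ, 0 < δ → ∀ i, (B i + δ • (1 : Matrix ν ν ℝ)).PosDef := fun δ hδ i =>
    PosDef.posSemidef_add (hB i) (PosDef.one.smul hδ)
  set F : ℝ → Matrix ν ν ℝ := fun δ => (∑ i, t i • (B i + δ • (1 : Matrix ν ν ℝ))⁻¹)⁻¹ with hF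
  have hFp : ∀ δ, 0 < δ → (F δ).PosDef := fun δ hδ => (posDef_sum_smul_inv ht (hP δ hδ)).inv
  have hFs : ∀ δ, 0 < δ → (F δ).IsSymm := fun δ hδ =>
    isHermitian_iff_isSymm.1 (hFp δ hδ).isHermitian
  have hquad : ∀ (i : ι) (v : ν → ℝ), Monotone
      fun δ : ℝ => v ⬝ᵥ ((B i + δ • (1 : Matrix ν ν ℝ)) *ᵥ v) := fun i v δ δ' hδ => by
    have : 0 ≤ v ⬝ᵥ v := by simpa using dotProduct_star_self_nonneg v
    simp only [add_mulVec, smul_mulVec, one_mulVec, dotProduct_add, dotProduct_smul, smul_eq_mul]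
    nlinarith
  have hmono : ∀ v, MonotoneOn (fun δ => v ⬝ᵥ (F δ *ᵥ v)) (Set.Ioi 0) := by
    intro v δ hδ δ' hδ' hle
    refine dotProduct_le_harmonic ht (hP δ' hδ') (fun h => ?_) v
    refine (dotProduct_harmonic_le ht (hP δ hδ) h).trans ?_
    exact Finset.sum_le_sum fun i _ => mul_le_mul_of_nonneg_left (hquad i (h i) hle) (ht i).le
  obtain ⟨H, hH⟩ := exists_tendsto_of_monotoneOn hFs hmono
    fun δ hδ v => (posSemidef_iff_of_isSymm (hFs δ hδ)).1 (hFp δ hδ).posSemidef v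
  have hHs : H.IsSymm := by
    have h1 : Tendsto (fun δ => (F δ)ᵀ) (𝓝[>] 0) (𝓝 Hᵀ) :=
      (continuous_id.matrix_transpose.tendsto H).comp hH
    refine tendsto_nhds_unique (h1.congr' ?_) hH
    filter_upwards [self_mem_nhdsWithin] with δ hδ using hFs δ hδ
  refine ⟨H, hH, (posSemidef_sub_iff hHs hCs).2 fun v => ?_⟩
  have hc : Continuous fun M : Matrix ν ν ℝ => v ⬝ᵥ (M *ᵥ v) := by fun_prop
  refine ge_of_tendsto ((hc.tendsto H).comp hH) ?_
  filter_upwards [self_mem_nhdsWithin] with δ hδ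
  refine dotProduct_le_harmonic ht (hP δ hδ) (fun h => (hC h).trans ?_) v
  refine Finset.sum_le_sum fun i _ => mul_le_mul_of_nonneg_left ?_ (ht i).le
  have := hquad i (h i) (le_of_lt (Set.mem_Ioi.1 hδ))
  simpa using this

end Matrix

/-! ### Application to the infimal convolution -/

theorem infConv_toReal_le {n k : ℕ} {t : Fin (k + 1) → ℝ} (ht : ∀ i, 0 < t i)
    {Ω : Fin (k + 1) → Set (EuclideanSpace ℝ (Fin n))}
    {v : Fin (k + 1) → EuclideanSpace ℝ (Fin n) → ℝ} (hv : ∀ i, BddBelow (v i '' Ω i))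
    {y : Fin (k + 1) → EuclideanSpace ℝ (Fin n)} (hy : ∀ i, y i ∈ Ω i) :
    (infConv t Ω v (∑ i, t i • y i)).toReal ≤ ∑ i, t i * v i (y i) := by
  rw [← EReal.coe_le_coe_iff, infConv_finite t ht Ω v hv _ ⟨y, hy, rfl⟩]
  refine (iInf_le _ ⟨y, rfl⟩).trans_eq ?_
  have hsum : ∀ s : Finset (Fin (k + 1)), ∑ i ∈ s, (t i : EReal) * extendTop (Ω i) (v i) (y i)
      = ((∑ i ∈ s, t i * v i (y i) : ℝ) : EReal) := fun s => by
    induction s using Finset.induction_on with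
    | empty => simp
    | insert i s hi ih =>
      rw [Finset.sum_insert hi, Finset.sum_insert hi, ih, EReal.coe_add, EReal.coe_mul]
      simp [extendTop, hy i]
  exact hsum _

section MatrixForms

variable {n : ℕ}

theorem inner_toEuclideanLin (B : Matrix (Fin n) (Fin n) ℝ) (v w : EuclideanSpace ℝ (Fin n)) :
    inner ℝ (Matrix.toEuclideanLin B v) w = w.ofLp ⬝ᵥ (B.mulVec v.ofLp) := by
  simp [EuclideanSpace.inner_eq_star_dotProduct, Matrix.toLpLin_apply]

theorem isSymm_of_inner_symm {B : Matrix (Fin n) (Fin n) ℝ}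
    (h : ∀ v w, inner ℝ (Matrix.toEuclideanLin B v) w = inner ℝ (Matrix.toEuclideanLin B w) v) :
    B.IsSymm := by
  rw [← Matrix.isHermitian_iff_isSymm, ← Matrix.isSymmetric_toEuclideanLin_iff]
  intro v w
  rw [h, real_inner_comm]

theorem inner_symm_of_isSymm {B : Matrix (Fin n) (Fin n) ℝ} (h : B.IsSymm)
    (v w : EuclideanSpace ℝ (Fin n)) :
    inner ℝ (Matrix.toEuclideanLin B v) w = inner ℝ (Matrix.toEuclideanLin B w) v := by
  rw [inner_toEuclideanLin, inner_toEuclideanLin, Matrix.dotProduct_mulVec_comm_of_isSymm h]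

/-- The matrix of a continuous linear map of a Euclidean space. -/
def euclideanMatrix : (EuclideanSpace ℝ (Fin n) →L[ℝ] EuclideanSpace ℝ (Fin n)) →ₗ[ℝ]
    Matrix (Fin n) (Fin n) ℝ :=
  (Matrix.toEuclideanLin (𝕜 := ℝ) (m := Fin n) (n := Fin n)).symm.toLinearMap ∘ₗ
    ContinuousLinearMap.coeLM ℝ

theorem toEuclideanLin_euclideanMatrix
    (X : EuclideanSpace ℝ (Fin n) →L[ℝ] EuclideanSpace ℝ (Fin n)) (v : EuclideanSpace ℝ (Fin n)) :
    Matrix.toEuclideanLin (euclideanMatrix X) v = X v := by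
  simp [euclideanMatrix]

end MatrixForms

theorem exists_closedSubjets {n k : ℕ}
    {Ω : Fin (k + 1) → Set (EuclideanSpace ℝ (Fin n))} (hΩ_open : ∀ i, IsOpen (Ω i))
    {t : Fin (k + 1) → ℝ} (ht : ∀ i, 0 < t i) (ht_sum : ∑ i, t i = 1)
    {v : Fin (k + 1) → EuclideanSpace ℝ (Fin n) → ℝ}
    (hv_cont : ∀ i, ContinuousOn (v i) (Ω i)) (hv_bdd : ∀ i, BddBelow (v i '' Ω i))
    {xs : Fin (k + 1) → EuclideanSpace ℝ (Fin n)} (hxs : ∀ i, xs i ∈ Ω i)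
    (hexact : infConv t Ω v (∑ i, t i • xs i) = ((∑ i, t i * v i (xs i) : ℝ) : EReal))
    {ξ : EuclideanSpace ℝ (Fin n)} {A : Matrix (Fin n) (Fin n) ℝ}
    (hA : (ξ, A) ∈ subjet (minkowskiComb t Ω) (fun y => (infConv t Ω v y).toReal)
      (∑ i, t i • xs i))
    {ε : ℝ} (hε : 0 < ε) :
    ∃ B : Fin (k + 1) → Matrix (Fin n) (Fin n) ℝ, (∀ i, (B i).IsSymm) ∧
      (∀ i, (ξ, B i) ∈ closedSubjet (Ω i) (v i) (xs i)) ∧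
      ∀ h : Fin (k + 1) → Fin n → ℝ,
        (∑ i, t i • h i) ⬝ᵥ ((A - ε • A ^ 2).mulVec (∑ i, t i • h i)) ≤
          ∑ i, t i * (h i ⬝ᵥ ((B i).mulVec (h i))) := by
  obtain ⟨hAs, hAjet⟩ := hA
  obtain ⟨R, hR, hball⟩ : ∃ R : ℝ, 0 < R ∧ ∀ i, closedBall (xs i) R ⊆ Ω i := by
    have h1 : ∀ i, ∀ᶠ R in 𝓝[>] (0 : ℝ), closedBall (xs i) R ⊆ Ω i := fun i =>
      (eventually_closedBall_subset ((hΩ_open i).mem_nhds (hxs i))).filter_mono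
        nhdsWithin_le_nhds
    exact (eventually_mem_nhdsWithin.and (eventually_all.2 h1)).exists
  set L : EuclideanSpace ℝ (Fin n) →L[ℝ] EuclideanSpace ℝ (Fin n) :=
    (Matrix.toEuclideanLin A).toContinuousLinearMap with hL
  have hLA : ∀ w, L w = Matrix.toEuclideanLin A w := fun w => rfl
  set g : Fin (k + 1) → EuclideanSpace ℝ (Fin n) → ℝ :=
    fun i y => v i (xs i + y) - v i (xs i) - inner ℝ ξ y with hg
  have hmem : ∀ i (y : EuclideanSpace ℝ (Fin n)), ‖y‖ ≤ R → xs i + y ∈ Ω i := fun i y hy =>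
    hball i (by simpa [dist_eq_norm] using hy)
  have hgc : ∀ i, ContinuousOn (g i) (closedBall 0 R) := fun i => by
    have h1 : ContinuousOn (fun y => v i (xs i + y)) (closedBall 0 R) :=
      (hv_cont i).comp (by fun_prop) fun y hy => hmem i y (by simpa using hy)
    exact (h1.sub continuousOn_const).sub (by fun_prop)
  -- The jet inequality for $w$ at $\sum t_i(x_i+y_i)$, with $w$ replaced by the larger competitor
  -- sum; exactness at $x$ cancels the constants.
  have hge : ∀ η : ℝ, 0 < η → ∀ᶠ y in 𝓝 (0 : Fin (k + 1) → EuclideanSpace ℝ (Fin n)),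
      (1 / 2) * coupling L t y - η * ‖∑ i, t i • y i‖ ^ 2 ≤ ∑ i, t i * g i (y i) := by
    intro η hη
    have hin : ∀ᶠ y in 𝓝 (0 : Fin (k + 1) → EuclideanSpace ℝ (Fin n)), ∀ i, xs i + y i ∈ Ω i := by
      filter_upwards [closedBall_mem_nhds (0 : Fin (k + 1) → EuclideanSpace ℝ (Fin n)) hR]
        with y hy i
      exact hmem i _ ((norm_le_pi_norm y i).trans (by simpa using hy))
    have hlim : Tendsto (fun y : Fin (k + 1) → EuclideanSpace ℝ (Fin n) =>
        ∑ i, t i • (xs i + y i)) (𝓝 0) (𝓝[minkowskiComb t Ω] (∑ i, t i • xs i)) := by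
      refine tendsto_nhdsWithin_iff.2 ⟨?_, hin.mono fun y hy => ⟨_, hy, rfl⟩⟩
      have : Continuous (fun y : Fin (k + 1) → EuclideanSpace ℝ (Fin n) =>
        ∑ i, t i • (xs i + y i)) := by fun_prop
      simpa using this.tendsto 0
    filter_upwards [hin, hlim.eventually (hAjet η hη)] with y hy1 hy2
    have e1 : ∑ i, t i • (xs i + y i) - ∑ i, t i • xs i = ∑ i, t i • y i := by
      simp [smul_add, Finset.sum_add_distrib]
    have e2 := infConv_toReal_le ht hv_bdd hy1
    have e3 : ∑ i, t i * g i (y i) = ∑ i, t i * v i (xs i + y i) - ∑ i, t i * v i (xs i)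
        - inner ℝ ξ (∑ i, t i • y i) := by
      simp only [hg, mul_sub, Finset.sum_sub_distrib, inner_sum, real_inner_smul_right]
    simp only [e1, hexact, EReal.toReal_coe] at hy2
    rw [e3]
    unfold coupling
    simp only [hLA]
    linarith
  obtain ⟨a, p, Y, X, haR, ha, hp, hY, hYs, hYt, hX⟩ := exists_limit_subjets hR ht ht_sum
    (fun w w' => by rw [hLA, hLA]; exact inner_symm_of_isSymm hAs w w') hgc (fun i => by simp [hg])
    hge hε
  have hMc : Continuous (euclideanMatrix (n := n)) := LinearMap.continuous_of_finiteDimensional _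
  have hYi : ∀ i, Tendsto (fun m => euclideanMatrix (Y m i)) atTop (𝓝 (euclideanMatrix (X i))) :=
    fun i => (hMc.tendsto _).comp (tendsto_pi_nhds.1 hY i)
  have hYsymm : ∀ m i, (euclideanMatrix (Y m i)).IsSymm := fun m i =>
    isSymm_of_inner_symm fun w w' => by
      rw [toEuclideanLin_euclideanMatrix, toEuclideanLin_euclideanMatrix, hYs]
  refine ⟨fun i => euclideanMatrix (X i), fun i => ?_, fun i => ?_, fun h => ?_⟩
  · have h1 : Tendsto (fun m => (euclideanMatrix (Y m i)).transpose) atTop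
        (𝓝 (euclideanMatrix (X i)).transpose) :=
      (continuous_id.matrix_transpose.tendsto _).comp (hYi i)
    exact tendsto_nhds_unique (h1.congr fun m => hYsymm m i) (hYi i)
  · have hz : Tendsto (fun m => xs i + a m i) atTop (𝓝 (xs i)) := by
      simpa using (tendsto_pi_nhds.1 ha i).const_add (xs i)
    refine ⟨fun m => xs i + a m i, fun m => (ξ + p m i, euclideanMatrix (Y m i)),
      fun m => hmem i _ (haR m i).le, fun m => ⟨hYsymm m i, fun η hη => ?_⟩, hz,
      (((hv_cont i).continuousAt ((hΩ_open i).mem_nhds (hxs i))).tendsto).comp hz, ?_⟩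
    · refine Filter.Eventually.filter_mono nhdsWithin_le_nhds ?_
      have hlim : Tendsto (fun y => y - xs i) (𝓝 (xs i + a m i)) (𝓝 (a m i)) := by
        have : Continuous (fun y => y - xs i) := by fun_prop
        simpa using this.tendsto (xs i + a m i)
      filter_upwards [hlim.eventually (hYt m i η hη)] with y hy
      have e1 : y - xs i - a m i = y - (xs i + a m i) := by abel
      have e2 : inner ℝ ξ (y - xs i) = inner ℝ ξ (a m i) + inner ℝ ξ (y - (xs i + a m i)) := by
        rw [← inner_add_right]; congr 1; abel
      simp only [hg, e1, e2, add_sub_cancel] at hy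
      simp only [inner_add_left, toEuclideanLin_euclideanMatrix]
      linarith
    · have h1 : Tendsto (fun m => ξ + p m i) atTop (𝓝 ξ) := by
        simpa using (tendsto_pi_nhds.1 hp i).const_add ξ
      exact h1.prodMk_nhds (hYi i)
  · have h1 := hX fun i => WithLp.toLp 2 (h i)
    have e1 : ∀ i, inner ℝ (X i (WithLp.toLp 2 (h i))) (WithLp.toLp 2 (h i))
        = h i ⬝ᵥ ((euclideanMatrix (X i)).mulVec (h i)) := fun i => by
      rw [← toEuclideanLin_euclideanMatrix, inner_toEuclideanLin]
    have e2 : ∑ i, t i • (WithLp.toLp 2 (h i) : EuclideanSpace ℝ (Fin n))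
        = WithLp.toLp 2 (∑ i, t i • h i) := by
      simp [WithLp.toLp_sum]
    have e3 : ∀ w : EuclideanSpace ℝ (Fin n), inner ℝ ((L - ε • L.comp L) w) w
        = w.ofLp ⬝ᵥ ((A - ε • A ^ 2).mulVec w.ofLp) := fun w => by
      rw [← inner_toEuclideanLin]
      congr 1
      simp only [sub_apply, smul_apply, ContinuousLinearMap.comp_apply, hLA, map_sub, map_smul,
        Matrix.toLpLin_apply, pow_two, Matrix.mulVec_mulVec, LinearMap.sub_apply,
        LinearMap.smul_apply]
    unfold coupling at h1
    simp only [e1] at h1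
    rw [e2, e3] at h1
    exact h1

/-- Both summands of the identity are congruences of positive semidefinite matrices, so no square
root or diagonalization is needed. -/
theorem Matrix.posSemidef_sub_smul_sq {n : ℕ} {A : Matrix (Fin n) (Fin n) ℝ} {ε : ℝ}
    (hε : 0 < ε) (hA : A.PosSemidef) (hεA : (1 - ε • A).PosDef) : (A - ε • A ^ 2).PosSemidef := by
  have h1 : A - ε • A ^ 2 = (1 - ε • A) * A * (1 - ε • A) + ε • (A * (1 - ε • A) * A) := by
    simp only [mul_sub, sub_mul, mul_one, one_mul, Matrix.mul_smul, Matrix.smul_mul, pow_two,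
      smul_sub]
    abel
  rw [h1]
  have h2 := hA.conjTranspose_mul_mul_same (1 - ε • A)
  have h3 := hεA.posSemidef.conjTranspose_mul_mul_same A
  rw [hεA.isHermitian.eq] at h2
  rw [hA.isHermitian.eq] at h3
  exact h2.add (h3.smul hε.le)

end

theorem propositionp {n k : ℕ}
    (Ω : Fin (k + 1) → Set (EuclideanSpace ℝ (Fin n)))
    (hΩ_open : ∀ i, IsOpen (Ω i)) (hΩ_bdd : ∀ i, Bornology.IsBounded (Ω i))
    (t : Fin (k + 1) → ℝ) (ht : ∀ i, t i ∈ Set.Ioc (0 : ℝ) 1) (ht_sum : ∑ i, t i = 1)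
    (v : Fin (k + 1) → EuclideanSpace ℝ (Fin n) → ℝ)
    (hv_cont : ∀ i, ContinuousOn (v i) (Ω i)) (hv_bdd : ∀ i, BddBelow (v i '' Ω i))
    (x : EuclideanSpace ℝ (Fin n)) (xs : Fin (k + 1) → EuclideanSpace ℝ (Fin n))
    (hxs : ∀ i, xs i ∈ Ω i) (hx : x = ∑ i, t i • xs i)
    (hexact : infConv t Ω v x = ((∑ i, t i * v i (xs i) : ℝ) : EReal))
    (ξ : EuclideanSpace ℝ (Fin n)) (A : Matrix (Fin n) (Fin n) ℝ)
    (hA : (ξ, A) ∈ subjet (minkowskiComb t Ω) (fun y => (infConv t Ω v y).toReal) x)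
    (ε : ℝ) (hε : 0 < ε) :
    ∃ B : Fin (k + 1) → Matrix (Fin n) (Fin n) ℝ,
      (∀ i, (B i).IsSymm) ∧
      (∀ i, (ξ, B i) ∈ closedSubjet (Ω i) (v i) (xs i)) ∧
      ((∑ i, t i • B i) - (A - ε • A ^ 2)).PosSemidef ∧
      (A.PosSemidef → (1 - ε • A).PosDef →
        (∀ i, (B i).PosSemidef) ∧
        (∃ H, IsHarmonicMean t B H ∧ (H - (A - ε • A ^ 2)).PosSemidef) ∧
        ((∀ i, (B i).PosDef) →
          ((∑ i, t i • (B i)⁻¹)⁻¹ - (A - ε • A ^ 2)).PosSemidef)) := by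
  have ht0 : ∀ i, 0 < t i := fun i => (ht i).1
  have hAs : A.IsSymm := hA.1
  have hCs : (A - ε • A ^ 2).IsSymm := hAs.sub ((hAs.pow 2).smul ε)
  rw [hx] at hexact hA
  obtain ⟨B, hBs, hBj, hB⟩ := exists_closedSubjets hΩ_open ht0 ht_sum hv_cont hv_bdd hxs hexact
    hA hε
  refine ⟨B, hBs, hBj, ?_, fun hApos hεA => ?_⟩
  · have hSs : (∑ i, t i • B i).IsSymm := by
      rw [Matrix.IsSymm, Matrix.transpose_sum]
      exact Finset.sum_congr rfl fun i _ => (hBs i).smul (t i)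
    refine (Matrix.posSemidef_sub_iff hSs hCs).2 fun w => ?_
    -- With all $h_i=w$, $\sum t_ih_i=w$.
    have h1 := hB fun _ => w
    simpa only [← Finset.sum_smul, ht_sum, one_smul, Matrix.sum_mulVec, dotProduct_sum,
      Matrix.smul_mulVec, dotProduct_smul, smul_eq_mul] using h1
  · have hBpos : ∀ i, (B i).PosSemidef := fun i => by
      refine (Matrix.posSemidef_iff_of_isSymm (hBs i)).2 fun w => ?_
      -- Only the $i$-th term survives on the right, while the left side is nonnegative.
      have h1 := hB (Pi.single i w)
      have h2 := (Matrix.posSemidef_iff_of_isSymm hCs).1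
        (Matrix.posSemidef_sub_smul_sq hε hApos hεA)
        (∑ j, t j • (Pi.single i w : Fin (k + 1) → Fin n → ℝ) j)
      have h3 : ∑ j, t j * ((Pi.single i w : Fin (k + 1) → Fin n → ℝ) j ⬝ᵥ
          ((B j).mulVec ((Pi.single i w : Fin (k + 1) → Fin n → ℝ) j)))
          = t i * (w ⬝ᵥ ((B i).mulVec w)) := by
        rw [Finset.sum_eq_single i (fun j _ hj => by simp [Pi.single_eq_of_ne hj]) (by simp)]
        simp
      rw [h3] at h1
      exact nonneg_of_mul_nonneg_right (h2.trans h1) (ht0 i)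
    exact ⟨hBpos, Matrix.exists_harmonicMean ht0 hBpos hCs hB,
      fun hBd => Matrix.posSemidef_harmonic_sub ht0 hBd hCs hB⟩
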